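/- Let $\mathbb K$ be a field of characteristic $0$. A DG-Lie algebra over $\mathbb K$ is a (possibly unbounded) cochain complex $(A=\bigoplus_{n\in\mathbb Z}A^n,d)$ of $\mathbb K$-vector spaces, with $d$ of degree $+1$ and $d^2=0$, equipped with a bilinear bracket of degree $0$ such that, for homogeneous $x,y$ of degrees $\bar x,\bar y$ and every $z$, one has $[x,y]=-(-1)^{\bar x\bar y}[y,x]$, $[x,[y,z]]=[[x,y],z]+(-1)^{\bar x\bar y}[y,[x,z]]$ and $d[x,y]=[dx,y]+(-1)^{\bar x}[x,dy]$. For a complex $V$, the free DG-Lie algebra $\mathbb L(V)$ is the smallest graded Lie subalgebra of the tensor algebra $T(V)$, with the graded commutator bracket, that contains $V$; its differential is the restriction of the differential of $T(V)$. The coproduct $H\amalg M$ of two DG-Lie algebras is the quotient of $\mathbb L(H\oplus M)$ by the Lie ideal generated by the elements $[x,y]_H-[x,y]$ with $x,y\in H$ and $[u,v]_M-[u,v]$ with $u,v\in M$. **Proposition (free extensions are quasi-isomorphisms).** Let $A$ be a DG-Lie algebra over $\mathbb K$ and let $V$ be an acyclic (possibly unbounded) complex of $\mathbb K$-vector spaces.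 Then the canonical morphism of DG-Lie algebras $A\to A\amalg\mathbb L(V)$ is a quasi-isomorphism, that is, it induces an isomorphism $H^n(A)\to H^n(A\amalg\mathbb L(V))$ for every $n\in\mathbb Z$. -/

import Mathlib

open CategoryTheory

universe u

noncomputable section

/-! ## Complexes of vector spaces

A complex `V = ⨁ Vⁿ` is given by its total space, the subspaces `gr n = Vⁿ`, and a
differential of degree `+1`. -/

/-- A (cochain) complex of `K`-vector spaces, unbounded, internally graded by `ℤ`. -/
structure DGModule (K : Type u) [Field K] where
  carrier : Type u
  [addCommGroup : AddCommGroup carrier]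
  [module : Module K carrier]
  /-- the subspace of elements of degree `n` -/
  gr : ℤ → Submodule K carrier
  isInternal : DirectSum.IsInternal gr
  d : carrier →ₗ[K] carrier
  d_mem : ∀ {n : ℤ} {x : carrier}, x ∈ gr n → d x ∈ gr (n + 1)
  d_d : ∀ x : carrier, d (d x) = 0

attribute [instance] DGModule.addCommGroup DGModule.module

namespace DGModule

variable {K : Type u} [Field K]

/-- A morphism of complexes: a linear map of degree `0` commuting with the differentials. -/
structure Hom (V W : DGModule K) where
  toLin : V.carrier →ₗ[K] W.carrier
  map_mem : ∀ {n : ℤ} {x : V.carrier}, x ∈ V.gr n → toLin x ∈ W.gr n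
  map_d : ∀ x : V.carrier, toLin (V.d x) = W.d (toLin x)

/-- The Mathlib cochain complex `⋯ → Vⁿ → Vⁿ⁺¹ → ⋯` of a complex `V`. -/
def toCochainComplex (V : DGModule K) : CochainComplex (ModuleCat.{u} K) ℤ where
  X n := ModuleCat.of K (V.gr n)
  d i j :=
    if h : i + 1 = j then
      ModuleCat.ofHom (V.d.restrict (p := V.gr i) (q := V.gr j) (fun _ hx => h ▸ V.d_mem hx))
    else 0
  shape i j h := by
    have h' : ¬ i + 1 = j := h
    simp [h']
  d_comp_d' i j k hij hjk := by
    have h₁ : i + 1 = j := hij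
    have h₂ : j + 1 = k := hjk
    rw [dif_pos h₁, dif_pos h₂]
    ext x
    exact V.d_d _

/-- The map of Mathlib cochain complexes induced by a morphism of complexes. -/
def Hom.toCochainMap {V W : DGModule K} (f : Hom V W) :
    V.toCochainComplex ⟶ W.toCochainComplex where
  f n := ModuleCat.ofHom (f.toLin.restrict (p := V.gr n) (q := W.gr n) (fun _ hx => f.map_mem hx))
  comm' i j hij := by
    have h : i + 1 = j := hij
    subst h
    ext x
    simp only [toCochainComplex, dif_pos]
    exact Subtype.ext (f.map_d _).symm

/-- A complex is acyclic when all its cohomology vanishes. -/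
def Acyclic (V : DGModule K) : Prop := V.toCochainComplex.Acyclic

/-- A morphism of complexes is a quasi-isomorphism when it is an isomorphism on cohomology. -/
def Hom.IsQuasiIso {V W : DGModule K} (f : Hom V W) : Prop := QuasiIso f.toCochainMap

/-! ### Homogeneous components and signs -/

instance decomp (V : DGModule K) : DirectSum.Decomposition V.gr :=
  V.isInternal.chooseDecomposition

/-- The projection of `V` onto its component of degree `n`. -/
def proj (V : DGModule K) (n : ℤ) : V.carrier →ₗ[K] V.carrier :=
  (V.gr n).subtype ∘ₗ DirectSum.component K ℤ (fun i => V.gr i) n ∘ₗ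
    (DirectSum.decomposeLinearEquiv V.gr).toLinearMap

/-- The linear map `x ↦ (-1) ^ (m * n) • x` for `x` of degree `n`. -/
def gradedTwist {W : Type u} [AddCommGroup W] [Module K W] (gr : ℤ → Submodule K W)
    [DirectSum.Decomposition gr] (m : ℤ) : W →ₗ[K] W :=
  DirectSum.toModule K ℤ W (fun n => (m * n).negOnePow • (gr n).subtype) ∘ₗ
    (DirectSum.decomposeLinearEquiv gr).toLinearMap

theorem gradedTwist_of_mem {W : Type u} [AddCommGroup W] [Module K W] (gr : ℤ → Submodule K W)
    [DirectSum.Decomposition gr] (m : ℤ) {n : ℤ} {x : W} (hx : x ∈ gr n) :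
    gradedTwist gr m x = (m * n).negOnePow • x := by
  simp only [gradedTwist, LinearMap.comp_apply, LinearEquiv.coe_coe,
    DirectSum.decomposeLinearEquiv_apply]
  rw [DirectSum.decompose_of_mem gr hx]
  exact DirectSum.toModule_lof K (M := fun n => gr n) n (⟨x, hx⟩ : gr n)

/-- The linear map `x ↦ (-1) ^ (m * n) • x` for `x` of degree `n` on a complex. -/
def twist (V : DGModule K) (m : ℤ) : V.carrier →ₗ[K] V.carrier := gradedTwist V.gr m

theorem proj_apply (V : DGModule K) (n : ℤ) (x : V.carrier) :
    V.proj n x = (DirectSum.decompose V.gr x n : V.carrier) := rfl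

theorem proj_mem (V : DGModule K) (n : ℤ) (x : V.carrier) : V.proj n x ∈ V.gr n :=
  (DirectSum.decompose V.gr x n).2

theorem proj_same (V : DGModule K) {n : ℤ} {x : V.carrier} (hx : x ∈ V.gr n) :
    V.proj n x = x := DirectSum.decompose_of_mem_same V.gr hx

theorem proj_ne (V : DGModule K) {m n : ℤ} {x : V.carrier} (hx : x ∈ V.gr m) (h : m ≠ n) :
    V.proj n x = 0 := DirectSum.decompose_of_mem_ne V.gr hx h

theorem twist_of_mem (V : DGModule K) (m : ℤ) {n : ℤ} {x : V.carrier} (hx : x ∈ V.gr n) :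
    V.twist m x = (m * n).negOnePow • x := gradedTwist_of_mem V.gr m hx

theorem induction (V : DGModule K) {p : V.carrier → Prop} (zero : p 0)
    (hom : ∀ n x, x ∈ V.gr n → p x) (add : ∀ x y, p x → p y → p (x + y)) (x : V.carrier) :
    p x :=
  DirectSum.Decomposition.inductionOn V.gr zero (fun {i} m => hom i m m.2) add x

theorem mem_sum_proj (V : DGModule K) (S : Submodule K V.carrier) (x : V.carrier)
    (h : ∀ n, V.proj n x ∈ S) : x ∈ S := by
  classical
  rw [← DirectSum.sum_support_decompose V.gr x]
  exact Submodule.sum_mem _ fun n _ => h n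

theorem proj_d (V : DGModule K) (n : ℤ) (x : V.carrier) :
    V.proj (n + 1) (V.d x) = V.d (V.proj n x) := by
  induction x using V.induction with
  | zero => simp
  | add x y hx hy => simp [hx, hy]
  | hom m x hx =>
    by_cases h : m = n
    · subst h
      rw [V.proj_same hx, V.proj_same (V.d_mem hx)]
    · rw [V.proj_ne hx h, V.proj_ne (V.d_mem hx) (by omega), map_zero]

/-- A criterion for a family of subspaces to be a grading. -/
theorem isInternal_of_proj {W : Type u} [AddCommGroup W] [Module K W]
    (gr : ℤ → Submodule K W) (p : ℤ → W →ₗ[K] W)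
    (same : ∀ n x, x ∈ gr n → p n x = x) (ne : ∀ m n x, x ∈ gr m → m ≠ n → p n x = 0)
    (top : ∀ S : Submodule K W, (∀ n, gr n ≤ S) → ∀ x, x ∈ S) :
    DirectSum.IsInternal gr := by
  apply DirectSum.isInternal_submodule_of_iSupIndep_of_iSup_eq_top
  · intro i
    rw [Submodule.disjoint_def]
    intro x hx hx'
    rw [← same i x hx]
    have : (⨆ j, ⨆ (_ : j ≠ i), gr j) ≤ LinearMap.ker (p i) :=
      iSup_le fun j => iSup_le fun hj => fun y hy => ne j i y hy hj
    exact this hx'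
  · rw [eq_top_iff]
    intro x _
    exact top _ (fun n => le_iSup gr n) x

/-! ### Graded subspaces, subcomplexes, quotients, direct sums -/

/-- A subspace is graded when it contains the homogeneous components of its elements. -/
def IsGraded (V : DGModule K) (S : Submodule K V.carrier) : Prop :=
  ∀ x ∈ S, ∀ n : ℤ, V.proj n x ∈ S

theorem IsGraded.twist_mem {V : DGModule K} {S : Submodule K V.carrier} (hS : V.IsGraded S)
    (m : ℤ) {x : V.carrier} (hx : x ∈ S) : V.twist m x ∈ S := by
  classical
  rw [← DirectSum.sum_support_decompose V.gr x, map_sum]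
  refine Submodule.sum_mem _ fun n _ => ?_
  rw [V.twist_of_mem m (DirectSum.decompose V.gr x n).2, Units.smul_def]
  exact S.smul_of_tower_mem _ (hS x hx n)

theorem IsGraded.sInf {V : DGModule K} {s : Set (Submodule K V.carrier)}
    (hs : ∀ S ∈ s, V.IsGraded S) : V.IsGraded (InfSet.sInf s) := by
  intro x hx n
  rw [Submodule.mem_sInf] at hx ⊢
  exact fun S hS => hs S hS x (hx S hS) n

/-- The preimage of a graded subspace under the differential, inside that subspace. -/
def dStable (V : DGModule K) (S : Submodule K V.carrier) : Submodule K V.carrier :=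
  S ⊓ S.comap V.d

theorem IsGraded.dStable {V : DGModule K} {S : Submodule K V.carrier} (hS : V.IsGraded S) :
    V.IsGraded (V.dStable S) := by
  intro x hx n
  refine ⟨hS x hx.1 n, ?_⟩
  change V.d (V.proj n x) ∈ S
  rw [← V.proj_d]
  exact hS _ hx.2 _

/-- A graded subspace stable under `d`, as a complex. -/
def sub (V : DGModule K) (S : Submodule K V.carrier) (hS : V.IsGraded S)
    (hd : ∀ x ∈ S, V.d x ∈ S) : DGModule K where
  carrier := S
  gr n := (V.gr n).comap S.subtype
  isInternal := by
    refine isInternal_of_proj _ (fun n => (V.proj n).restrict fun x hx => hS x hx n) ?_ ?_ ?_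
    · intro n x hx
      exact Subtype.ext (V.proj_same hx)
    · intro m n x hx h
      exact Subtype.ext (V.proj_ne hx h)
    · intro T hT x
      have h : (x : V.carrier) ∈ T.map S.subtype := by
        refine V.mem_sum_proj _ _ fun n => ?_
        exact ⟨⟨V.proj n x, hS x x.2 n⟩, hT n (V.proj_mem n x), rfl⟩
      obtain ⟨y, hy, hyx⟩ := h
      have : y = x := Subtype.ext hyx
      exact this ▸ hy
  d := V.d.restrict hd
  d_mem hx := V.d_mem hx
  d_d x := Subtype.ext (V.d_d x)

/-- The quotient of a complex by a graded subspace stable under `d`. -/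
def quot (V : DGModule K) (S : Submodule K V.carrier) (hS : V.IsGraded S)
    (hd : ∀ x ∈ S, V.d x ∈ S) : DGModule K where
  carrier := V.carrier ⧸ S
  gr n := (V.gr n).map S.mkQ
  isInternal := by
    refine isInternal_of_proj _ (fun n => S.mapQ S (V.proj n) fun x hx => hS x hx n) ?_ ?_ ?_
    · rintro n _ ⟨x, hx, rfl⟩
      simp [V.proj_same hx]
    · rintro m n _ ⟨x, hx, rfl⟩ h
      simp [V.proj_ne hx h]
    · intro T hT x
      obtain ⟨x, rfl⟩ := S.mkQ_surjective x
      have : x ∈ T.comap S.mkQ :=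
        V.mem_sum_proj _ _ fun n => hT n ⟨_, V.proj_mem n x, rfl⟩
      exact this
  d := S.mapQ S V.d hd
  d_mem := by
    rintro n _ ⟨x, hx, rfl⟩
    exact ⟨V.d x, V.d_mem hx, by simp⟩
  d_d x := by
    obtain ⟨x, rfl⟩ := S.mkQ_surjective x
    simp [V.d_d]

/-- The direct sum `V ⊕ W` of two complexes. -/
def sum (V W : DGModule K) : DGModule K where
  carrier := V.carrier × W.carrier
  gr n := (V.gr n).prod (W.gr n)
  isInternal := by
    refine isInternal_of_proj _ (fun n => (V.proj n).prodMap (W.proj n)) ?_ ?_ ?_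
    · rintro n ⟨x, y⟩ ⟨hx, hy⟩
      exact Prod.ext (V.proj_same hx) (W.proj_same hy)
    · rintro m n ⟨x, y⟩ ⟨hx, hy⟩ h
      exact Prod.ext (V.proj_ne hx h) (W.proj_ne hy h)
    · rintro T hT ⟨x, y⟩
      have hx : x ∈ T.comap (LinearMap.inl K V.carrier W.carrier) :=
        V.mem_sum_proj _ _ fun n => hT n ⟨V.proj_mem n x, Submodule.zero_mem _⟩
      have hy : y ∈ T.comap (LinearMap.inr K V.carrier W.carrier) :=
        W.mem_sum_proj _ _ fun n => hT n ⟨Submodule.zero_mem _, W.proj_mem n y⟩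
      have := T.add_mem hx hy
      simpa using this
  d := V.d.prodMap W.d
  d_mem hx := ⟨V.d_mem hx.1, W.d_mem hx.2⟩
  d_d x := Prod.ext (V.d_d _) (W.d_d _)

/-- The inclusion `V → V ⊕ W`. -/
def sumInl (V W : DGModule K) : Hom V (V.sum W) where
  toLin := LinearMap.inl K V.carrier W.carrier
  map_mem hx := ⟨hx, Submodule.zero_mem _⟩
  map_d _ := Prod.ext rfl (map_zero W.d).symm

/-- The inclusion `W → V ⊕ W`. -/
def sumInr (V W : DGModule K) : Hom W (V.sum W) where
  toLin := LinearMap.inr K V.carrier W.carrier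
  map_mem hx := ⟨Submodule.zero_mem _, hx⟩
  map_d _ := Prod.ext (map_zero V.d).symm rfl

/-- The composition of morphisms of complexes. -/
def Hom.comp {V W X : DGModule K} (g : Hom W X) (f : Hom V W) : Hom V X where
  toLin := g.toLin ∘ₗ f.toLin
  map_mem hx := g.map_mem (f.map_mem hx)
  map_d x := (congrArg g.toLin (f.map_d x)).trans (g.map_d _)

/-! ### The tensor algebra of a complex -/

/-- The degree `n` part of `T(V)`: the span of the products `v₁ ⊗ ⋯ ⊗ vₛ` of homogeneous
elements whose degrees add up to `n`. -/
def tensorGr (V : DGModule K) (n : ℤ) : Submodule K (TensorAlgebra K V.carrier) :=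
  Submodule.span K {t | ∃ l : List (Σ i : ℤ, V.gr i), (l.map Sigma.fst).sum = n ∧
    t = (l.map fun v => TensorAlgebra.ι K (v.2 : V.carrier)).prod}

theorem ι_mem_tensorGr (V : DGModule K) {n : ℤ} {v : V.carrier} (hv : v ∈ V.gr n) :
    TensorAlgebra.ι K v ∈ V.tensorGr n :=
  Submodule.subset_span ⟨[⟨n, v, hv⟩], by simp, by simp⟩

instance tensorGr_gradedMonoid (V : DGModule K) : SetLike.GradedMonoid V.tensorGr where
  one_mem := Submodule.subset_span ⟨[], by simp, by simp⟩
  mul_mem := by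
    intro m n x y hx hy
    induction hx, hy using Submodule.span_induction₂ with
    | mem_mem x y hx hy =>
      obtain ⟨l, hl, rfl⟩ := hx
      obtain ⟨l', hl', rfl⟩ := hy
      exact Submodule.subset_span ⟨l ++ l', by simp [hl, hl'], by simp⟩
    | zero_left => simp
    | zero_right => simp
    | add_left x y z _ _ _ h₁ h₂ => rw [add_mul]; exact Submodule.add_mem _ h₁ h₂
    | add_right x y z _ _ _ h₁ h₂ => rw [mul_add]; exact Submodule.add_mem _ h₁ h₂
    | smul_left r x y _ _ h => rw [smul_mul_assoc]; exact Submodule.smul_mem _ _ h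
    | smul_right r x y _ _ h => rw [mul_smul_comm]; exact Submodule.smul_mem _ _ h

/-- The inclusion of `V` into the graded object underlying `T(V)`. -/
def tensorGrι (V : DGModule K) : V.carrier →ₗ[K] DirectSum ℤ (fun n => V.tensorGr n) :=
  DirectSum.toModule K ℤ _ (fun n =>
    DirectSum.lof K ℤ (fun n => V.tensorGr n) n ∘ₗ
      (TensorAlgebra.ι K).restrict (fun _ hv => V.ι_mem_tensorGr hv)) ∘ₗ
    (DirectSum.decomposeLinearEquiv V.gr).toLinearMap

theorem tensorGrι_of_mem (V : DGModule K) {n : ℤ} {v : V.carrier} (hv : v ∈ V.gr n) :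
    V.tensorGrι v = DirectSum.of (fun n => V.tensorGr n) n
      ⟨TensorAlgebra.ι K v, V.ι_mem_tensorGr hv⟩ := by
  simp only [tensorGrι, LinearMap.comp_apply, LinearEquiv.coe_coe,
    DirectSum.decomposeLinearEquiv_apply]
  rw [DirectSum.decompose_of_mem V.gr hv]
  exact DirectSum.toModule_lof K (M := fun n => V.gr n) n (⟨v, hv⟩ : V.gr n)

instance tensorGradedAlgebra (V : DGModule K) : GradedAlgebra V.tensorGr :=
  GradedAlgebra.ofAlgHom _ (TensorAlgebra.lift K V.tensorGrι)
    (by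
      ext v
      simp only [LinearMap.comp_apply, AlgHom.toLinearMap_apply, AlgHom.comp_apply,
        AlgHom.id_apply, TensorAlgebra.lift_ι_apply]
      induction v using V.induction with
      | zero => simp
      | add x y hx hy => simp [hx, hy]
      | hom n x hx => rw [V.tensorGrι_of_mem hx, DirectSum.coeAlgHom_of])
    (by
      rintro n ⟨x, hx⟩
      rw [← DirectSum.lof_eq_of K]
      dsimp only
      induction hx using Submodule.span_induction with
      | zero => rw [map_zero]; exact (map_zero _).symm
      | add x y hx hy h₁ h₂ => rw [map_add, h₁, h₂, ← map_add]; rfl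
      | smul r x hx h => rw [map_smul, h, ← map_smul]; rfl
      | mem x hx =>
        obtain ⟨l, hl, rfl⟩ := hx
        rw [DirectSum.lof_eq_of K]
        induction l generalizing n with
        | nil =>
          simp only [List.map_nil, List.sum_nil] at hl
          subst hl
          simp only [List.map_nil, List.prod_nil, map_one]
          rfl
        | cons v l ih =>
          have := ih (l.map Sigma.fst).sum rfl
          simp only [List.map_cons, List.prod_cons, map_mul, TensorAlgebra.lift_ι_apply]
          rw [this, V.tensorGrι_of_mem v.2.2, DirectSum.of_mul_of]
          exact DirectSum.of_eq_of_gradedMonoid_eq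
            (Sigma.subtype_ext (by simp only [List.map_cons, List.sum_cons] at hl; exact hl) rfl))

/-- The algebra map `x ↦ !![(-1) ^ |x| • x, d x; 0, x]`, which encodes the graded Leibniz rule. -/
def tensorMatrix (V : DGModule K) : TensorAlgebra K V.carrier →ₐ[K]
    Matrix (Fin 2) (Fin 2) (TensorAlgebra K V.carrier) :=
  TensorAlgebra.lift K
    { toFun := fun v => !![TensorAlgebra.ι K (V.twist 1 v), TensorAlgebra.ι K (V.d v);
        0, TensorAlgebra.ι K v]
      map_add' := fun x y => by ext i j; fin_cases i <;> fin_cases j <;> simp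
      map_smul' := fun r x => by ext i j; fin_cases i <;> fin_cases j <;> simp }

/-- The differential of `T(V)`: the graded derivation that extends the one of `V`. -/
def tensorD (V : DGModule K) : TensorAlgebra K V.carrier →ₗ[K] TensorAlgebra K V.carrier where
  toFun x := V.tensorMatrix x 0 1
  map_add' x y := by simp
  map_smul' r x := by simp

theorem tensorMatrix_ι (V : DGModule K) (v : V.carrier) :
    V.tensorMatrix (TensorAlgebra.ι K v) =
      !![TensorAlgebra.ι K (V.twist 1 v), TensorAlgebra.ι K (V.d v); 0, TensorAlgebra.ι K v] := by
  simp [tensorMatrix]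

theorem tensorD_ι (V : DGModule K) (v : V.carrier) :
    V.tensorD (TensorAlgebra.ι K v) = TensorAlgebra.ι K (V.d v) := by
  change V.tensorMatrix (TensorAlgebra.ι K v) 0 1 = _
  rw [tensorMatrix_ι]
  simp

theorem tensorMatrix_lower (V : DGModule K) (x : TensorAlgebra K V.carrier) :
    V.tensorMatrix x 1 0 = 0 ∧ V.tensorMatrix x 1 1 = x := by
  induction x using TensorAlgebra.induction with
  | algebraMap r => simp [Matrix.algebraMap_matrix_apply]
  | ι v => rw [tensorMatrix_ι]; simp
  | mul x y hx hy => simp [Matrix.mul_apply, Fin.sum_univ_two, hx, hy]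
  | add x y hx hy => simp [hx, hy]

theorem tensorMatrix_sign (V : DGModule K) {n : ℤ} {x : TensorAlgebra K V.carrier}
    (hx : x ∈ V.tensorGr n) : V.tensorMatrix x 0 0 = n.negOnePow • x := by
  induction hx using Submodule.span_induction with
  | zero => simp
  | add x y _ _ hx hy => simp [hx, hy]
  | smul r x _ hx => rw [map_smul, Matrix.smul_apply, hx, Units.smul_def, Units.smul_def, smul_comm]
  | mem x hx =>
    obtain ⟨l, hl, rfl⟩ := hx
    induction l generalizing n with
    | nil => simp only [List.map_nil, List.sum_nil] at hl; subst hl; simp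
    | cons v l ih =>
      have := ih (n := (l.map Sigma.fst).sum) rfl
      simp only [List.map_cons, List.sum_cons] at hl
      simp only [List.map_cons, List.prod_cons, map_mul, Matrix.mul_apply, Fin.sum_univ_two,
        this, (V.tensorMatrix_lower _).1, mul_zero, add_zero, tensorMatrix_ι]
      rw [← hl, Int.negOnePow_add]
      rw [V.twist_of_mem 1 v.2.2, one_mul]
      rcases Int.units_eq_one_or v.1.negOnePow with h | h <;> rw [h] <;> simp [mul_smul_comm]

/-- The graded Leibniz rule on `T(V)`. -/
theorem tensorD_mul (V : DGModule K) {n : ℤ} {x : TensorAlgebra K V.carrier}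
    (hx : x ∈ V.tensorGr n) (y : TensorAlgebra K V.carrier) :
    V.tensorD (x * y) = V.tensorD x * y + n.negOnePow • (x * V.tensorD y) := by
  change V.tensorMatrix (x * y) 0 1 = V.tensorMatrix x 0 1 * y + _ • (x * V.tensorMatrix y 0 1)
  rw [map_mul, Matrix.mul_apply, Fin.sum_univ_two, V.tensorMatrix_sign hx,
    (V.tensorMatrix_lower y).2, smul_mul_assoc, add_comm]

theorem tensorD_one (V : DGModule K) : V.tensorD 1 = 0 := by
  change V.tensorMatrix 1 0 1 = 0
  simp

theorem tensorD_mem (V : DGModule K) {n : ℤ} {x : TensorAlgebra K V.carrier}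
    (hx : x ∈ V.tensorGr n) : V.tensorD x ∈ V.tensorGr (n + 1) := by
  induction hx using Submodule.span_induction with
  | zero => simp
  | add x y _ _ hx hy => rw [map_add]; exact Submodule.add_mem _ hx hy
  | smul r x _ hx => rw [map_smul]; exact Submodule.smul_mem _ _ hx
  | mem x hx =>
    obtain ⟨l, hl, rfl⟩ := hx
    induction l generalizing n with
    | nil => simp [tensorD_one]
    | cons v l ih =>
      have h := ih (n := (l.map Sigma.fst).sum) rfl
      have hm : (l.map fun v => TensorAlgebra.ι K (v.2 : V.carrier)).prod ∈
          V.tensorGr (l.map Sigma.fst).sum := Submodule.subset_span ⟨l, rfl, rfl⟩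
      simp only [List.map_cons, List.sum_cons] at hl
      simp only [List.map_cons, List.prod_cons]
      rw [V.tensorD_mul (V.ι_mem_tensorGr v.2.2), V.tensorD_ι]
      refine Submodule.add_mem _ ?_ ?_
      · have := SetLike.mul_mem_graded (V.ι_mem_tensorGr (V.d_mem v.2.2)) hm
        rwa [show v.1 + 1 + (l.map Sigma.fst).sum = n + 1 by omega] at this
      · have := SetLike.mul_mem_graded (V.ι_mem_tensorGr v.2.2) h
        rw [show v.1 + ((l.map Sigma.fst).sum + 1) = n + 1 by omega] at this
        rw [Units.smul_def]
        exact Submodule.smul_of_tower_mem _ _ this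

theorem tensorD_tensorD (V : DGModule K) (x : TensorAlgebra K V.carrier) :
    V.tensorD (V.tensorD x) = 0 := by
  induction x using DirectSum.Decomposition.inductionOn V.tensorGr with
  | zero => simp
  | add x y hx hy => simp [hx, hy]
  | @homogeneous n x =>
    obtain ⟨x, hx⟩ := x
    dsimp only
    induction hx using Submodule.span_induction with
    | zero => simp
    | add x y _ _ hx hy => rw [map_add, map_add, hx, hy, add_zero]
    | smul r x _ hx => rw [map_smul, map_smul, hx, smul_zero]
    | mem x hx =>
      obtain ⟨l, -, rfl⟩ := hx
      induction l with
      | nil => simp [tensorD_one]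
      | cons v l ih =>
        simp only [List.map_cons, List.prod_cons]
        rw [V.tensorD_mul (V.ι_mem_tensorGr v.2.2), V.tensorD_ι, map_add,
          V.tensorD_mul (V.ι_mem_tensorGr (V.d_mem v.2.2)), V.tensorD_ι, V.d_d,
          Units.smul_def v.1.negOnePow, map_zsmul, V.tensorD_mul (V.ι_mem_tensorGr v.2.2), V.tensorD_ι, ih,
          Int.negOnePow_succ]
        simp [Units.smul_def]

/-- The tensor algebra `T(V)` as a complex. -/
def tensor (V : DGModule K) : DGModule K where
  carrier := TensorAlgebra K V.carrier
  gr := V.tensorGr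
  isInternal := DirectSum.Decomposition.isInternal V.tensorGr
  d := V.tensorD
  d_mem := V.tensorD_mem
  d_d := V.tensorD_tensorD

end DGModule

/-! ## DG-Lie algebras -/

/-- A DG-Lie algebra: a complex with a bilinear bracket of degree `0` that is graded
antisymmetric and satisfies the graded Jacobi identity, and for which `d` is a graded
derivation. -/
structure DGLieAlgebra (K : Type u) [Field K] extends DGModule K where
  bracket : carrier →ₗ[K] carrier →ₗ[K] carrier
  bracket_mem : ∀ {m n : ℤ} {x y : carrier}, x ∈ gr m → y ∈ gr n → bracket x y ∈ gr (m + n)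
  bracket_skew : ∀ {m n : ℤ} {x y : carrier}, x ∈ gr m → y ∈ gr n →
    bracket x y = -((m * n).negOnePow • bracket y x)
  jacobi : ∀ {m n : ℤ} {x y : carrier}, x ∈ gr m → y ∈ gr n → ∀ z : carrier,
    bracket x (bracket y z) =
      bracket (bracket x y) z + (m * n).negOnePow • bracket y (bracket x z)
  d_bracket : ∀ {m : ℤ} {x : carrier}, x ∈ gr m → ∀ y : carrier,
    d (bracket x y) = bracket (d x) y + m.negOnePow • bracket x (d y)

namespace DGLieAlgebra

variable {K : Type u} [Field K]

/-- A morphism of DG-Lie algebras. -/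
structure Hom (L M : DGLieAlgebra K) extends DGModule.Hom L.toDGModule M.toDGModule where
  map_bracket : ∀ x y : L.carrier, toLin (L.bracket x y) = M.bracket (toLin x) (toLin y)

theorem d_bracket' (L : DGLieAlgebra K) (x y : L.carrier) :
    L.d (L.bracket x y) = L.bracket (L.d x) y + L.bracket (L.twist 1 x) (L.d y) := by
  induction x using L.induction with
  | zero => simp
  | add a b ha hb => simp only [map_add, LinearMap.add_apply, ha, hb]; abel
  | hom n x hx =>
    rw [L.d_bracket hx, L.twist_of_mem 1 hx, one_mul, Units.smul_def, Units.smul_def, map_zsmul,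
      LinearMap.smul_apply]

/-- The graded Lie subalgebra generated by a set: the intersection of all graded subspaces
that contain it and are closed under the bracket. -/
def lieSpan (L : DGLieAlgebra K) (s : Set L.carrier) : Submodule K L.carrier :=
  sInf {S | L.IsGraded S ∧ s ⊆ S ∧ ∀ x ∈ S, ∀ y ∈ S, L.bracket x y ∈ S}

/-- The (graded) Lie ideal generated by a set: the intersection of all graded subspaces that
contain it and are stable under the bracket with arbitrary elements. -/
def idealSpan (L : DGLieAlgebra K) (s : Set L.carrier) : Submodule K L.carrier :=
  sInf {S | L.IsGraded S ∧ s ⊆ S ∧ ∀ x, ∀ y ∈ S, L.bracket x y ∈ S}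

theorem lieSpan_isGraded (L : DGLieAlgebra K) (s : Set L.carrier) :
    L.IsGraded (L.lieSpan s) := DGModule.IsGraded.sInf fun _ h => h.1

theorem idealSpan_isGraded (L : DGLieAlgebra K) (s : Set L.carrier) :
    L.IsGraded (L.idealSpan s) := DGModule.IsGraded.sInf fun _ h => h.1

theorem subset_lieSpan (L : DGLieAlgebra K) (s : Set L.carrier) : s ⊆ L.lieSpan s :=
  fun _ hx => Submodule.mem_sInf.2 fun _ h => h.2.1 hx

theorem subset_idealSpan (L : DGLieAlgebra K) (s : Set L.carrier) : s ⊆ L.idealSpan s :=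
  fun _ hx => Submodule.mem_sInf.2 fun _ h => h.2.1 hx

theorem bracket_mem_lieSpan (L : DGLieAlgebra K) {s : Set L.carrier} {x y : L.carrier}
    (hx : x ∈ L.lieSpan s) (hy : y ∈ L.lieSpan s) : L.bracket x y ∈ L.lieSpan s :=
  Submodule.mem_sInf.2 fun S h =>
    h.2.2 x (Submodule.mem_sInf.1 hx S h) y (Submodule.mem_sInf.1 hy S h)

theorem bracket_mem_idealSpan (L : DGLieAlgebra K) {s : Set L.carrier} (x : L.carrier)
    {y : L.carrier} (hy : y ∈ L.idealSpan s) : L.bracket x y ∈ L.idealSpan s :=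
  Submodule.mem_sInf.2 fun S h => h.2.2 x y (Submodule.mem_sInf.1 hy S h)

theorem d_mem_lieSpan (L : DGLieAlgebra K) {s : Set L.carrier}
    (hs : ∀ x ∈ s, L.d x ∈ L.lieSpan s) : ∀ x ∈ L.lieSpan s, L.d x ∈ L.lieSpan s := by
  have h : L.lieSpan s ≤ L.dStable (L.lieSpan s) := by
    refine sInf_le (show _ ∧ _ ∧ _ from ⟨(L.lieSpan_isGraded s).dStable,
      fun x hx => ⟨L.subset_lieSpan s hx, hs x hx⟩, fun x hx y hy => ?_⟩)
    refine ⟨L.bracket_mem_lieSpan hx.1 hy.1, ?_⟩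
    change L.d (L.bracket x y) ∈ L.lieSpan s
    rw [L.d_bracket']
    exact Submodule.add_mem _ (L.bracket_mem_lieSpan hx.2 hy.1)
      (L.bracket_mem_lieSpan ((L.lieSpan_isGraded s).twist_mem 1 hx.1) hy.2)
  exact fun x hx => (h hx).2

theorem d_mem_idealSpan (L : DGLieAlgebra K) {s : Set L.carrier}
    (hs : ∀ x ∈ s, L.d x ∈ L.idealSpan s) : ∀ x ∈ L.idealSpan s, L.d x ∈ L.idealSpan s := by
  have h : L.idealSpan s ≤ L.dStable (L.idealSpan s) := by
    refine sInf_le (show _ ∧ _ ∧ _ from ⟨(L.idealSpan_isGraded s).dStable,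
      fun x hx => ⟨L.subset_idealSpan s hx, hs x hx⟩, fun x y hy => ?_⟩)
    refine ⟨L.bracket_mem_idealSpan x hy.1, ?_⟩
    change L.d (L.bracket x y) ∈ L.idealSpan s
    rw [L.d_bracket']
    exact Submodule.add_mem _ (L.bracket_mem_idealSpan _ hy.1) (L.bracket_mem_idealSpan _ hy.2)
  exact fun x hx => (h hx).2

/-- A graded Lie subalgebra stable under `d`, as a DG-Lie algebra. -/
def sub (L : DGLieAlgebra K) (S : Submodule K L.carrier) (hS : L.IsGraded S)
    (hd : ∀ x ∈ S, L.d x ∈ S) (hb : ∀ x ∈ S, ∀ y ∈ S, L.bracket x y ∈ S) : DGLieAlgebra K where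
  toDGModule := L.toDGModule.sub S hS hd
  bracket := LinearMap.mk₂ K
    (fun x y : S => (⟨L.bracket x.1 y.1, hb x.1 x.2 y.1 y.2⟩ : S))
    (fun x y z => Subtype.ext (LinearMap.map_add₂ L.bracket x.1 y.1 z.1))
    (fun r x y => Subtype.ext (LinearMap.map_smul₂ L.bracket r x.1 y.1))
    (fun x y z => Subtype.ext (map_add (L.bracket x.1) y.1 z.1))
    (fun r x y => Subtype.ext (map_smul (L.bracket x.1) r y.1))
  bracket_mem hx hy := L.bracket_mem hx hy
  bracket_skew hx hy := Subtype.ext (L.bracket_skew hx hy)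
  jacobi hx hy z := Subtype.ext (L.jacobi hx hy z.1)
  d_bracket hx y := Subtype.ext (L.d_bracket hx y.1)

theorem bracket_mem_left (L : DGLieAlgebra K) {S : Submodule K L.carrier} (hS : L.IsGraded S)
    (hb : ∀ x, ∀ y ∈ S, L.bracket x y ∈ S) (x : L.carrier) (hx : x ∈ S) (y : L.carrier) :
    L.bracket x y ∈ S := by
  classical
  rw [← DirectSum.sum_support_decompose L.gr x, map_sum, LinearMap.sum_apply]
  refine Submodule.sum_mem _ fun m _ => ?_
  induction y using L.induction with
  | zero => simp
  | add y z hy hz => rw [map_add]; exact Submodule.add_mem _ hy hz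
  | hom n y hy =>
    rw [L.bracket_skew (DirectSum.decompose L.gr x m).2 hy, Units.smul_def]
    exact Submodule.neg_mem _ (Submodule.smul_of_tower_mem _ _ (hb y _ (hS x hx m)))

/-- The quotient of a DG-Lie algebra by a graded Lie ideal stable under `d`. -/
def quot (L : DGLieAlgebra K) (S : Submodule K L.carrier) (hS : L.IsGraded S)
    (hd : ∀ x ∈ S, L.d x ∈ S) (hb : ∀ x, ∀ y ∈ S, L.bracket x y ∈ S) : DGLieAlgebra K where
  toDGModule := L.toDGModule.quot S hS hd
  bracket := S.liftQ
    { toFun := fun x => S.mapQ S (L.bracket x) (hb x)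
      map_add' := fun x y => by
        apply LinearMap.ext
        intro z
        obtain ⟨z, rfl⟩ := S.mkQ_surjective z
        exact congrArg S.mkQ (LinearMap.map_add₂ L.bracket x y z)
      map_smul' := fun r x => by
        apply LinearMap.ext
        intro z
        obtain ⟨z, rfl⟩ := S.mkQ_surjective z
        exact congrArg S.mkQ (LinearMap.map_smul₂ L.bracket r x z) }
    (fun x hx => by
      rw [LinearMap.mem_ker]
      apply LinearMap.ext
      intro z
      obtain ⟨z, rfl⟩ := S.mkQ_surjective z
      exact (Submodule.Quotient.mk_eq_zero S).2 (L.bracket_mem_left hS hb x hx z))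
  bracket_mem := by
    rintro m n _ _ ⟨x, hx, rfl⟩ ⟨y, hy, rfl⟩
    exact ⟨_, L.bracket_mem hx hy, rfl⟩
  bracket_skew := by
    rintro m n _ _ ⟨x, hx, rfl⟩ ⟨y, hy, rfl⟩
    exact congrArg S.mkQ (L.bracket_skew hx hy)
  jacobi := by
    rintro m n _ _ ⟨x, hx, rfl⟩ ⟨y, hy, rfl⟩ z
    obtain ⟨z, rfl⟩ := S.mkQ_surjective z
    exact congrArg S.mkQ (L.jacobi hx hy z)
  d_bracket := by
    rintro m _ ⟨x, hx, rfl⟩ y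
    obtain ⟨y, rfl⟩ := S.mkQ_surjective y
    exact congrArg S.mkQ (L.d_bracket hx y)

/-! ### The tensor algebra as a DG-Lie algebra -/

/-- The bilinear map on `T(V)` with `(x, y) ↦ (-1) ^ (m * n) y x` for `x`, `y` of degrees
`m`, `n`. -/
def tensorFlip (V : DGModule K) : TensorAlgebra K V.carrier →ₗ[K]
    TensorAlgebra K V.carrier →ₗ[K] TensorAlgebra K V.carrier :=
  DirectSum.toModule K ℤ (TensorAlgebra K V.carrier →ₗ[K] TensorAlgebra K V.carrier)
    (fun m => LinearMap.lcomp K (TensorAlgebra K V.carrier)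
        (DGModule.gradedTwist V.tensorGr m) ∘ₗ
      (LinearMap.mul K (TensorAlgebra K V.carrier)).flip ∘ₗ (V.tensorGr m).subtype) ∘ₗ
  (DirectSum.decomposeLinearEquiv V.tensorGr).toLinearMap

theorem tensorFlip_of_mem (V : DGModule K) {m n : ℤ} {x y : TensorAlgebra K V.carrier}
    (hx : x ∈ V.tensorGr m) (hy : y ∈ V.tensorGr n) :
    tensorFlip V x y = (m * n).negOnePow • (y * x) := by
  simp only [tensorFlip, LinearMap.comp_apply, LinearEquiv.coe_coe,
    DirectSum.decomposeLinearEquiv_apply]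
  rw [DirectSum.decompose_of_mem V.tensorGr hx, ← DirectSum.lof_eq_of K,
    DirectSum.toModule_lof]
  change DGModule.gradedTwist V.tensorGr m y * x = _
  rw [DGModule.gradedTwist_of_mem V.tensorGr m hy, smul_mul_assoc]

/-- The graded commutator of `T(V)`: `x y - (-1) ^ (m * n) y x` for `x`, `y` of degrees
`m`, `n`, extended bilinearly. -/
def tensorBracket (V : DGModule K) : TensorAlgebra K V.carrier →ₗ[K]
    TensorAlgebra K V.carrier →ₗ[K] TensorAlgebra K V.carrier :=
  LinearMap.mul K (TensorAlgebra K V.carrier) - tensorFlip V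

theorem tensorBracket_of_mem (V : DGModule K) {m n : ℤ} {x y : TensorAlgebra K V.carrier}
    (hx : x ∈ V.tensorGr m) (hy : y ∈ V.tensorGr n) :
    tensorBracket V x y = x * y - (m * n).negOnePow • (y * x) := by
  rw [← tensorFlip_of_mem V hx hy]
  rfl

theorem tensorBracket_mem (V : DGModule K) {m n : ℤ} {x y : TensorAlgebra K V.carrier}
    (hx : x ∈ V.tensorGr m) (hy : y ∈ V.tensorGr n) :
    tensorBracket V x y ∈ V.tensorGr (m + n) := by
  rw [tensorBracket_of_mem V hx hy]
  refine Submodule.sub_mem _ (SetLike.mul_mem_graded hx hy) ?_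
  rw [Units.smul_def, add_comm m n]
  exact zsmul_mem (SetLike.mul_mem_graded hy hx) _

theorem tensorBracket_skew (V : DGModule K) {m n : ℤ} {x y : TensorAlgebra K V.carrier}
    (hx : x ∈ V.tensorGr m) (hy : y ∈ V.tensorGr n) :
    tensorBracket V x y = -((m * n).negOnePow • tensorBracket V y x) := by
  rw [tensorBracket_of_mem V hx hy, tensorBracket_of_mem V hy hx, mul_comm n m]
  rcases Int.units_eq_one_or (m * n).negOnePow with h | h <;> rw [h] <;> simp [add_comm]

theorem tensorBracket_jacobi (V : DGModule K) {m n : ℤ} {x y : TensorAlgebra K V.carrier}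
    (hx : x ∈ V.tensorGr m) (hy : y ∈ V.tensorGr n) (z : TensorAlgebra K V.carrier) :
    tensorBracket V x (tensorBracket V y z) =
      tensorBracket V (tensorBracket V x y) z +
        (m * n).negOnePow • tensorBracket V y (tensorBracket V x z) := by
  induction z using DirectSum.Decomposition.inductionOn V.tensorGr with
  | zero => simp
  | add z w hz hw => simp only [map_add, hz, hw, smul_add]; abel
  | @homogeneous p z =>
    obtain ⟨z, hz⟩ := z
    dsimp only
    rw [tensorBracket_of_mem V hx (tensorBracket_mem V hy hz),
      tensorBracket_of_mem V (tensorBracket_mem V hx hy) hz,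
      tensorBracket_of_mem V hy (tensorBracket_mem V hx hz),
      tensorBracket_of_mem V hx hy, tensorBracket_of_mem V hx hz,
      tensorBracket_of_mem V hy hz, mul_add, mul_add, add_mul, Int.negOnePow_add,
      Int.negOnePow_add, Int.negOnePow_add, mul_comm n m]
    rcases Int.units_eq_one_or (m * n).negOnePow with h₁ | h₁ <;>
    rcases Int.units_eq_one_or (m * p).negOnePow with h₂ | h₂ <;>
    rcases Int.units_eq_one_or (n * p).negOnePow with h₃ | h₃ <;>
    rw [h₁, h₂, h₃] <;>
    simp only [mul_one, mul_neg, neg_neg, one_smul, Units.neg_smul, sub_neg_eq_add] <;>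
    noncomm_ring

theorem tensorD_tensorBracket (V : DGModule K) {m : ℤ} {x : TensorAlgebra K V.carrier}
    (hx : x ∈ V.tensorGr m) (y : TensorAlgebra K V.carrier) :
    V.tensorD (tensorBracket V x y) =
      tensorBracket V (V.tensorD x) y + m.negOnePow • tensorBracket V x (V.tensorD y) := by
  induction y using DirectSum.Decomposition.inductionOn V.tensorGr with
  | zero => simp
  | add z w hz hw => simp only [map_add, hz, hw, smul_add]; abel
  | @homogeneous p y =>
    obtain ⟨y, hy⟩ := y
    dsimp only
    rw [tensorBracket_of_mem V hx hy, tensorBracket_of_mem V (V.tensorD_mem hx) hy,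
      tensorBracket_of_mem V hx (V.tensorD_mem hy), map_sub,
      Units.smul_def (m * p).negOnePow, map_zsmul, V.tensorD_mul hx, V.tensorD_mul hy,
      ← Units.smul_def, add_mul, mul_add, one_mul, mul_one, Int.negOnePow_add,
      Int.negOnePow_add]
    rcases Int.units_eq_one_or (m * p).negOnePow with h₁ | h₁ <;>
    rcases Int.units_eq_one_or m.negOnePow with h₂ | h₂ <;>
    rcases Int.units_eq_one_or p.negOnePow with h₃ | h₃ <;>
    rw [h₁, h₂, h₃] <;>
    simp only [mul_one, mul_neg, neg_neg, one_smul, Units.neg_smul, sub_neg_eq_add] <;>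
    abel

/-- The DG-Lie algebra `T(V)_L`. -/
def tensor (V : DGModule K) : DGLieAlgebra K where
  toDGModule := V.tensor
  bracket := tensorBracket V
  bracket_mem := tensorBracket_mem V
  bracket_skew := tensorBracket_skew V
  jacobi := tensorBracket_jacobi V
  d_bracket := tensorD_tensorBracket V

/-! ### Free DG-Lie algebras and coproducts -/

/-- The free DG-Lie algebra `𝕃(V)` on a complex `V`: the smallest graded Lie subalgebra of
`T(V)_L` that contains `V`, with the differential of `T(V)`. -/
def free (V : DGModule K) : DGLieAlgebra K :=
  (tensor V).sub ((tensor V).lieSpan (Set.range (TensorAlgebra.ι K : V.carrier →ₗ[K] _)))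
    ((tensor V).lieSpan_isGraded _)
    ((tensor V).d_mem_lieSpan (by
      rintro _ ⟨v, rfl⟩
      exact (tensor V).subset_lieSpan _ ⟨V.d v, (V.tensorD_ι v).symm⟩))
    (fun _ hx _ hy => (tensor V).bracket_mem_lieSpan hx hy)

/-- The inclusion `V → 𝕃(V)`. -/
def freeι (V : DGModule K) : DGModule.Hom V (free V).toDGModule where
  toLin := (TensorAlgebra.ι K : V.carrier →ₗ[K] _).codRestrict
    ((tensor V).lieSpan (Set.range (TensorAlgebra.ι K : V.carrier →ₗ[K] _)))
    (fun v => (tensor V).subset_lieSpan _ ⟨v, rfl⟩)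
  map_mem hx := V.ι_mem_tensorGr hx
  map_d v := Subtype.ext (V.tensorD_ι v).symm

/-- The morphism of complexes `H → 𝕃(H ⊕ M)`. -/
def coprodLeft (H M : DGLieAlgebra K) :
    DGModule.Hom H.toDGModule (free (H.toDGModule.sum M.toDGModule)).toDGModule :=
  (freeι (H.toDGModule.sum M.toDGModule)).comp (H.toDGModule.sumInl M.toDGModule)

/-- The morphism of complexes `M → 𝕃(H ⊕ M)`. -/
def coprodRight (H M : DGLieAlgebra K) :
    DGModule.Hom M.toDGModule (free (H.toDGModule.sum M.toDGModule)).toDGModule :=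
  (freeι (H.toDGModule.sum M.toDGModule)).comp (H.toDGModule.sumInr M.toDGModule)

/-- The elements `[x, y]_H - [x, y]` and `[u, v]_M - [u, v]` of `𝕃(H ⊕ M)`. -/
def coprodRel (H M : DGLieAlgebra K) :
    Set (free (H.toDGModule.sum M.toDGModule)).carrier :=
  {z | ∃ x y : H.carrier, z = (coprodLeft H M).toLin (H.bracket x y) -
    (free (H.toDGModule.sum M.toDGModule)).bracket ((coprodLeft H M).toLin x) ((coprodLeft H M).toLin y)} ∪
  {z | ∃ u v : M.carrier, z = (coprodRight H M).toLin (M.bracket u v) -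
    (free (H.toDGModule.sum M.toDGModule)).bracket ((coprodRight H M).toLin u) ((coprodRight H M).toLin v)}

/-- The Lie ideal of `𝕃(H ⊕ M)` generated by the elements `coprodRel`. -/
def coprodIdeal (H M : DGLieAlgebra K) :
    Submodule K (free (H.toDGModule.sum M.toDGModule)).carrier :=
  (free (H.toDGModule.sum M.toDGModule)).idealSpan (coprodRel H M)

/-- For a morphism of complexes, the differential of an element `[x, y] - [f x, f y]` is a sum
of two elements of the same form. -/
theorem d_rel {H L : DGLieAlgebra K} (f : DGModule.Hom H.toDGModule L.toDGModule)
    (x y : H.carrier) :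
    L.d (f.toLin (H.bracket x y) - L.bracket (f.toLin x) (f.toLin y)) =
      (f.toLin (H.bracket (H.d x) y) - L.bracket (f.toLin (H.d x)) (f.toLin y)) +
      (f.toLin (H.bracket (H.twist 1 x) (H.d y)) - L.bracket (f.toLin (H.twist 1 x)) (f.toLin (H.d y))) := by
  have ht : f.toLin (H.twist 1 x) = L.twist 1 (f.toLin x) := by
    induction x using H.induction with
    | zero => simp
    | add a b ha hb => simp [ha, hb]
    | hom n x hx =>
      rw [H.twist_of_mem 1 hx, L.twist_of_mem 1 (f.map_mem hx), Units.smul_def, Units.smul_def,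
        map_zsmul]
  rw [map_sub, ← f.map_d, H.d_bracket', L.d_bracket', ht, f.map_d, f.map_d, map_add]
  abel

/-- The coproduct `H ⨿ M` of two DG-Lie algebras: the quotient of `𝕃(H ⊕ M)` by the Lie ideal
generated by the elements `[x, y]_H - [x, y]` and `[u, v]_M - [u, v]`. -/
def coprod (H M : DGLieAlgebra K) : DGLieAlgebra K :=
  (free (H.toDGModule.sum M.toDGModule)).quot (coprodIdeal H M)
    ((free (H.toDGModule.sum M.toDGModule)).idealSpan_isGraded _)
    ((free (H.toDGModule.sum M.toDGModule)).d_mem_idealSpan (by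
      rintro _ (⟨x, y, rfl⟩ | ⟨x, y, rfl⟩)
      · rw [d_rel (coprodLeft H M)]
        exact Submodule.add_mem _
          ((free (H.toDGModule.sum M.toDGModule)).subset_idealSpan _ (Or.inl ⟨_, _, rfl⟩))
          ((free (H.toDGModule.sum M.toDGModule)).subset_idealSpan _ (Or.inl ⟨_, _, rfl⟩))
      · rw [d_rel (coprodRight H M)]
        exact Submodule.add_mem _
          ((free (H.toDGModule.sum M.toDGModule)).subset_idealSpan _ (Or.inr ⟨_, _, rfl⟩))
          ((free (H.toDGModule.sum M.toDGModule)).subset_idealSpan _ (Or.inr ⟨_, _, rfl⟩))))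
    (fun x _ hy => (free (H.toDGModule.sum M.toDGModule)).bracket_mem_idealSpan x hy)

/-- The canonical morphism `H → H ⨿ M`. -/
def inl (H M : DGLieAlgebra K) : Hom H (coprod H M) where
  toLin := (coprodIdeal H M).mkQ ∘ₗ (coprodLeft H M).toLin
  map_mem hx := ⟨_, (coprodLeft H M).map_mem hx, rfl⟩
  map_d x := by
    change (coprodIdeal H M).mkQ ((coprodLeft H M).toLin (H.d x)) = _
    rw [(coprodLeft H M).map_d]
    rfl
  map_bracket x y := by
    change (coprodIdeal H M).mkQ ((coprodLeft H M).toLin (H.bracket x y)) = (coprodIdeal H M).mkQ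
      ((free (H.toDGModule.sum M.toDGModule)).bracket ((coprodLeft H M).toLin x) ((coprodLeft H M).toLin y))
    rw [← sub_eq_zero, ← map_sub]
    exact (Submodule.Quotient.mk_eq_zero _).2
      ((free (H.toDGModule.sum M.toDGModule)).subset_idealSpan _ (Or.inl ⟨x, y, rfl⟩))

/-- The canonical morphism `M → H ⨿ M`. -/
def inr (H M : DGLieAlgebra K) : Hom M (coprod H M) where
  toLin := (coprodIdeal H M).mkQ ∘ₗ (coprodRight H M).toLin
  map_mem hx := ⟨_, (coprodRight H M).map_mem hx, rfl⟩
  map_d x := by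
    change (coprodIdeal H M).mkQ ((coprodRight H M).toLin (M.d x)) = _
    rw [(coprodRight H M).map_d]
    rfl
  map_bracket x y := by
    change (coprodIdeal H M).mkQ ((coprodRight H M).toLin (M.bracket x y)) = (coprodIdeal H M).mkQ
      ((free (H.toDGModule.sum M.toDGModule)).bracket ((coprodRight H M).toLin x) ((coprodRight H M).toLin y))
    rw [← sub_eq_zero, ← map_sub]
    exact (Submodule.Quotient.mk_eq_zero _).2
      ((free (H.toDGModule.sum M.toDGModule)).subset_idealSpan _ (Or.inr ⟨x, y, rfl⟩))

end DGLieAlgebra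

end

/-! Over a field an acyclic complex `V` is contractible: there is `h` of degree `-1` with `d h + h d
= id` (`Acyclic.exists_homotopy`). Extend `h` to the derivation of `A ⨿ 𝕃(V)` that vanishes on `A`
(`relativeDer`). The graded commutator of `d` with it is a derivation of degree `0` that is zero on
`A` and the identity on `V`, hence the Euler derivation `N` counting letters from `V`
(`d_relativeDer`).

The derivation `N` commutes with `d`, and `A ⨿ 𝕃(V)` is the image of `A`, where `N = 0`, plus a span
of eigenvectors with eigenvalues `1, 2, 3, …` (`exists_eq_inl_add`). In characteristic `0`, `N` is
bijective on the second summand (`eq_zero_of_euler_eq_zero`, `exists_euler_eq`). Being homotopic to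
zero, it makes every cycle there a boundary. This gives surjectivity on cohomology.

Injectivity follows from the retraction `A ⨿ 𝕃(V) → A` that kills `V` (`coprodDesc`). It needs the
universal property of `𝕃(V)`, which is not immediate when `𝕃(V)` is defined inside `T(V)`. The
extension of `V → L` is given by the Dynkin–Specht–Wever formula: replacing each word `v₁ ⊗ ⋯ ⊗ vₖ`
by a nested bracket multiplies Lie elements of length `k` by `k`, and characteristic `0` allows
division by `k` (`IteratedBracket.nestedRep_one`, `freeLift`). -/

noncomputable section

/-! ### Linear endomorphisms of degree `e` of a complex. -/

namespace DGModule

variable {K : Type u} [Field K]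

/-- A linear endomorphism of degree `e`. -/
def HasDegree (V : DGModule K) (e : ℤ) (D : V.carrier →ₗ[K] V.carrier) : Prop :=
  ∀ (n : ℤ) (x : V.carrier), x ∈ V.gr n → D x ∈ V.gr (n + e)

theorem HasDegree.zero (V : DGModule K) (e : ℤ) : V.HasDegree e 0 :=
  fun _ _ _ => Submodule.zero_mem _

theorem HasDegree.id (V : DGModule K) : V.HasDegree 0 LinearMap.id :=
  fun _ _ hx => by rwa [add_zero]

theorem HasDegree.prodMap {V W : DGModule K} {e : ℤ} {D : V.carrier →ₗ[K] V.carrier}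
    {E : W.carrier →ₗ[K] W.carrier} (hD : V.HasDegree e D) (hE : W.HasDegree e E) :
    (V.sum W).HasDegree e (D.prodMap E) :=
  fun _ _ hx => ⟨hD _ _ hx.1, hE _ _ hx.2⟩

theorem HasDegree.proj {V : DGModule K} {e : ℤ} {D : V.carrier →ₗ[K] V.carrier}
    (hD : V.HasDegree e D) (n : ℤ) (x : V.carrier) :
    V.proj (n + e) (D x) = D (V.proj n x) := by
  induction x using V.induction with
  | zero => simp
  | add x y hx hy => simp [hx, hy]
  | hom m x hx =>
    by_cases h : m = n
    · subst h
      rw [V.proj_same hx, V.proj_same (hD _ _ hx)]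
    · rw [V.proj_ne hx h, V.proj_ne (hD _ _ hx) (by omega), map_zero]

/-- Generated subalgebras and ideals are infima of graded subspaces. Their stability under `D` is
proved by comparing them with `S ∩ D⁻¹(S)`, which therefore has to be graded. -/
theorem HasDegree.isGraded_inf_comap {V : DGModule K} {e : ℤ} {D : V.carrier →ₗ[K] V.carrier}
    (hD : V.HasDegree e D) {S : Submodule K V.carrier} (hS : V.IsGraded S) :
    V.IsGraded (S ⊓ S.comap D) := by
  intro x hx n
  refine ⟨hS x hx.1 n, ?_⟩
  change D (V.proj n x) ∈ S
  rw [← hD.proj]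
  exact hS _ hx.2 _

theorem isGraded_span {V : DGModule K} {s : Set V.carrier} (hs : ∀ x ∈ s, ∃ n, x ∈ V.gr n) :
    V.IsGraded (Submodule.span K s) := by
  intro x hx n
  induction hx using Submodule.span_induction with
  | zero => simp
  | add x y _ _ hx hy => rw [map_add]; exact Submodule.add_mem _ hx hy
  | smul r x _ hx => rw [map_smul]; exact Submodule.smul_mem _ _ hx
  | mem x hx =>
    obtain ⟨m, hm⟩ := hs x hx
    by_cases h : m = n
    · subst h
      rw [V.proj_same hm]
      exact Submodule.subset_span hx
    · rw [V.proj_ne hm h]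
      exact Submodule.zero_mem _

theorem Hom.map_twist {V W : DGModule K} (f : Hom V W) (m : ℤ) (x : V.carrier) :
    f.toLin (V.twist m x) = W.twist m (f.toLin x) := by
  induction x using V.induction with
  | zero => simp
  | add a b ha hb => simp [ha, hb]
  | hom n x hx =>
    rw [V.twist_of_mem m hx, W.twist_of_mem m (f.map_mem hx), Units.smul_def, Units.smul_def,
      map_zsmul]

/-! ### Derivations of the tensor algebra -/

/-- The algebra map `x ↦ !![(-1) ^ (e * |x|) • x, D x; 0, x]`, where `D` is a graded derivation of
degree `e`. -/
def derMatrix (V : DGModule K) (e : ℤ) (D : V.carrier →ₗ[K] V.carrier) :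
    TensorAlgebra K V.carrier →ₐ[K] Matrix (Fin 2) (Fin 2) (TensorAlgebra K V.carrier) :=
  TensorAlgebra.lift K
    { toFun := fun v => !![TensorAlgebra.ι K (V.twist e v), TensorAlgebra.ι K (D v);
        0, TensorAlgebra.ι K v]
      map_add' := fun x y => by ext i j; fin_cases i <;> fin_cases j <;> simp
      map_smul' := fun r x => by ext i j; fin_cases i <;> fin_cases j <;> simp }

/-- The graded derivation of degree `e` of `T(V)` that extends a linear map `D` of degree `e`. -/
def tensorDer (V : DGModule K) (e : ℤ) (D : V.carrier →ₗ[K] V.carrier) :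
    TensorAlgebra K V.carrier →ₗ[K] TensorAlgebra K V.carrier where
  toFun x := V.derMatrix e D x 0 1
  map_add' x y := by simp
  map_smul' r x := by simp

variable (V : DGModule K) (e : ℤ) (D : V.carrier →ₗ[K] V.carrier)

theorem derMatrix_ι (v : V.carrier) :
    V.derMatrix e D (TensorAlgebra.ι K v) =
      !![TensorAlgebra.ι K (V.twist e v), TensorAlgebra.ι K (D v); 0, TensorAlgebra.ι K v] := by
  simp [derMatrix]

theorem tensorDer_ι (v : V.carrier) :
    V.tensorDer e D (TensorAlgebra.ι K v) = TensorAlgebra.ι K (D v) := by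
  change V.derMatrix e D (TensorAlgebra.ι K v) 0 1 = _
  rw [derMatrix_ι]
  simp

/-- Upper triangularity, with `x` itself in the lower right corner, turns the upper right entry of a
product into the two terms of the Leibniz rule. -/
theorem derMatrix_lower (x : TensorAlgebra K V.carrier) :
    V.derMatrix e D x 1 0 = 0 ∧ V.derMatrix e D x 1 1 = x := by
  induction x using TensorAlgebra.induction with
  | algebraMap r => simp [Matrix.algebraMap_matrix_apply]
  | ι v => rw [derMatrix_ι]; simp
  | mul x y hx hy => simp [Matrix.mul_apply, Fin.sum_univ_two, hx, hy]
  | add x y hx hy => simp [hx, hy]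

/-- An induction principle for homogeneous elements of the tensor algebra. -/
theorem tensorGr_induction {p : ℤ → TensorAlgebra K V.carrier → Prop}
    (zero : ∀ n, p n 0) (add : ∀ n x y, p n x → p n y → p n (x + y))
    (smul : ∀ n (r : K) x, p n x → p n (r • x)) (one : p 0 1)
    (mul : ∀ m n v x, v ∈ V.gr m → x ∈ V.tensorGr n → p n x →
      p (m + n) (TensorAlgebra.ι K v * x))
    {n : ℤ} {x : TensorAlgebra K V.carrier} (hx : x ∈ V.tensorGr n) : p n x := by
  induction hx using Submodule.span_induction with
  | zero => exact zero n
  | add x y _ _ hx hy => exact add n x y hx hy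
  | smul r x _ hx => exact smul n r x hx
  | mem x hx =>
    obtain ⟨l, hl, rfl⟩ := hx
    induction l generalizing n with
    | nil => simp only [List.map_nil, List.sum_nil] at hl; subst hl; exact one
    | cons v l ih =>
      simp only [List.map_cons, List.sum_cons] at hl
      rw [← hl, List.map_cons, List.prod_cons]
      exact mul _ _ _ _ v.2.2 (Submodule.subset_span ⟨l, rfl, rfl⟩) (ih rfl)

theorem derMatrix_sign {n : ℤ} {x : TensorAlgebra K V.carrier}
    (hx : x ∈ V.tensorGr n) : V.derMatrix e D x 0 0 = (e * n).negOnePow • x := by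
  refine V.tensorGr_induction (p := fun n x => V.derMatrix e D x 0 0 = (e * n).negOnePow • x)
    ?_ ?_ ?_ ?_ ?_ hx
  · simp
  · intro n x y hx hy
    simp [hx, hy]
  · intro n r x hx
    rw [map_smul, Matrix.smul_apply, hx, Units.smul_def, Units.smul_def, smul_comm]
  · simp
  · intro m n v x hv _ hx
    simp only [map_mul, Matrix.mul_apply, Fin.sum_univ_two, hx, (V.derMatrix_lower e D _).1,
      mul_zero, add_zero, derMatrix_ι]
    rw [mul_add, Int.negOnePow_add, V.twist_of_mem e hv]
    rcases Int.units_eq_one_or (e * m).negOnePow with h | h <;> rw [h] <;> simp [mul_smul_comm]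

/-- The graded Leibniz rule for `tensorDer`. -/
theorem tensorDer_mul {n : ℤ} {x : TensorAlgebra K V.carrier}
    (hx : x ∈ V.tensorGr n) (y : TensorAlgebra K V.carrier) :
    V.tensorDer e D (x * y) =
      V.tensorDer e D x * y + (e * n).negOnePow • (x * V.tensorDer e D y) := by
  change V.derMatrix e D (x * y) 0 1 =
    V.derMatrix e D x 0 1 * y + _ • (x * V.derMatrix e D y 0 1)
  rw [map_mul, Matrix.mul_apply, Fin.sum_univ_two, V.derMatrix_sign e D hx,
    (V.derMatrix_lower e D y).2, smul_mul_assoc, add_comm]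

theorem tensorDer_one : V.tensorDer e D 1 = 0 := by
  change V.derMatrix e D 1 0 1 = 0
  simp

variable {V e D}

theorem HasDegree.tensorDer (hD : V.HasDegree e D) :
    V.tensor.HasDegree e (V.tensorDer e D) := by
  intro n x hx
  refine V.tensorGr_induction (p := fun n x => V.tensorDer e D x ∈ V.tensorGr (n + e))
    ?_ ?_ ?_ ?_ ?_ hx
  · simp
  · intro n x y hx hy
    rw [map_add]
    exact Submodule.add_mem _ hx hy
  · intro n r x hx
    rw [map_smul]
    exact Submodule.smul_mem _ _ hx
  · simp [tensorDer_one]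
  · intro m n v x hv hx h
    rw [V.tensorDer_mul e D (V.ι_mem_tensorGr hv), V.tensorDer_ι]
    refine Submodule.add_mem _ ?_ ?_
    · have := SetLike.mul_mem_graded (V.ι_mem_tensorGr (hD _ _ hv)) hx
      rwa [show m + e + n = m + n + e by omega] at this
    · have := SetLike.mul_mem_graded (V.ι_mem_tensorGr hv) h
      rw [← add_assoc] at this
      rw [Units.smul_def]
      exact Submodule.smul_of_tower_mem _ _ this

/-- If a map `h` of degree `-1` has `d h + h d = N`, the derivations of `T(V)` that they define
satisfy the same identity. -/
theorem tensorD_tensorDer {h N : V.carrier →ₗ[K] V.carrier} (hh : V.HasDegree (-1) h)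
    (H : ∀ v, V.d (h v) + h (V.d v) = N v) (x : TensorAlgebra K V.carrier) :
    V.tensorD (V.tensorDer (-1) h x) + V.tensorDer (-1) h (V.tensorD x) = V.tensorDer 0 N x := by
  induction x using DirectSum.Decomposition.inductionOn V.tensorGr with
  | zero => simp
  | add x y hx hy => simp only [map_add, ← hx, ← hy]; abel
  | @homogeneous n x =>
    obtain ⟨x, hx⟩ := x
    dsimp only
    refine V.tensorGr_induction (p := fun _ x => V.tensorD (V.tensorDer (-1) h x) +
      V.tensorDer (-1) h (V.tensorD x) = V.tensorDer 0 N x) ?_ ?_ ?_ ?_ ?_ hx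
    · simp
    · intro n x y hx hy
      simp only [map_add, ← hx, ← hy]
      abel
    · intro n r x hx
      simp only [map_smul, ← hx, smul_add]
    · simp [tensorDer_one, tensorD_one]
    · intro m n v x hv _ hx
      have hv' := V.ι_mem_tensorGr hv
      rw [V.tensorDer_mul _ h hv', V.tensorD_mul hv', V.tensorDer_mul _ N hv', V.tensorDer_ι,
        V.tensorDer_ι, V.tensorD_ι, Units.smul_def (-1 * m).negOnePow,
        Units.smul_def m.negOnePow, map_add, map_add, map_zsmul, map_zsmul,
        V.tensorD_mul (V.ι_mem_tensorGr (hh _ _ hv)), V.tensorD_mul hv',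
        V.tensorDer_mul _ h (V.ι_mem_tensorGr (V.d_mem hv)), V.tensorDer_mul _ h hv',
        V.tensorD_ι, V.tensorDer_ι, ← hx, ← H, map_add,
        Int.negOnePow_add, zero_mul, mul_add (-1 : ℤ), neg_one_mul, Int.negOnePow_add,
        Int.negOnePow_neg]
      simp only [tensorDer_ι, tensorD_ι, Int.negOnePow_neg]
      -- Only the parity of `m` matters. The mixed terms `dv · h(x)` and `h(v) · dx` each occur
      -- twice with opposite signs, so the sum is again a derivation, of degree `0`.
      rcases Int.units_eq_one_or m.negOnePow with h₂ | h₂ <;>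
      simp only [h₂, Units.val_one, Units.val_neg, Int.negOnePow_neg, Int.negOnePow_one,
        Int.negOnePow_zero, one_smul, neg_smul, Units.neg_smul, mul_one, mul_neg, neg_neg,
        mul_add, add_mul] <;>
      abel

end DGModule

/-! ### Graded derivations of DG-Lie algebras, and their extension to free algebras and coproducts.
-/

namespace DGLieAlgebra

variable {K : Type u} [Field K]

/-- A linear endomorphism of degree `e` is a graded derivation of degree `e` when it satisfies the
graded Leibniz rule. -/
structure IsDer (L : DGLieAlgebra K) (e : ℤ) (D : L.carrier →ₗ[K] L.carrier) : Prop where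
  hasDegree : L.HasDegree e D
  leibniz : ∀ {m : ℤ} {x : L.carrier}, x ∈ L.gr m → ∀ y : L.carrier,
    D (L.bracket x y) = L.bracket (D x) y + (e * m).negOnePow • L.bracket x (D y)

namespace IsDer

variable {L : DGLieAlgebra K} {e : ℤ} {D : L.carrier →ₗ[K] L.carrier}

theorem zero (L : DGLieAlgebra K) (e : ℤ) : L.IsDer e 0 where
  hasDegree := DGModule.HasDegree.zero _ e
  leibniz _ _ := by simp

/-- Writing the sign as `twist e` removes the homogeneity condition on `x`; graded subspaces are
stable under `twist`. -/
theorem leibniz' (hD : L.IsDer e D) (x y : L.carrier) :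
    D (L.bracket x y) = L.bracket (D x) y + L.bracket (L.twist e x) (D y) := by
  induction x using L.induction with
  | zero => simp
  | add a b ha hb => simp only [map_add, LinearMap.add_apply, ha, hb]; abel
  | hom n x hx =>
    rw [hD.leibniz hx, L.twist_of_mem e hx, Units.smul_def, Units.smul_def, map_zsmul,
      LinearMap.smul_apply]

theorem leibniz_zero (hD : L.IsDer 0 D) (x y : L.carrier) :
    D (L.bracket x y) = L.bracket (D x) y + L.bracket x (D y) := by
  induction x using L.induction with
  | zero => simp
  | add a b ha hb => simp only [map_add, LinearMap.add_apply, ha, hb]; abel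
  | hom n x hx => simp [hD.leibniz hx]

/-- By the Leibniz rule, `S ∩ D⁻¹(S)` with `S = L.lieSpan s` is a graded subalgebra containing `s`,
so minimality of `S` puts `S` inside it. -/
theorem mem_lieSpan (hD : L.IsDer e D) {s : Set L.carrier}
    (hs : ∀ x ∈ s, D x ∈ L.lieSpan s) : ∀ x ∈ L.lieSpan s, D x ∈ L.lieSpan s := by
  have h : L.lieSpan s ≤ L.lieSpan s ⊓ (L.lieSpan s).comap D := by
    refine sInf_le (show _ ∧ _ ∧ _ from
      ⟨hD.hasDegree.isGraded_inf_comap (L.lieSpan_isGraded s),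
      fun x hx => ⟨L.subset_lieSpan s hx, hs x hx⟩, fun x hx y hy => ?_⟩)
    refine ⟨L.bracket_mem_lieSpan hx.1 hy.1, ?_⟩
    change D (L.bracket x y) ∈ L.lieSpan s
    rw [hD.leibniz']
    exact Submodule.add_mem _ (L.bracket_mem_lieSpan hx.2 hy.1)
      (L.bracket_mem_lieSpan ((L.lieSpan_isGraded s).twist_mem e hx.1) hy.2)
  exact fun x hx => (h hx).2

theorem mem_idealSpan (hD : L.IsDer e D) {s : Set L.carrier}
    (hs : ∀ x ∈ s, D x ∈ L.idealSpan s) : ∀ x ∈ L.idealSpan s, D x ∈ L.idealSpan s := by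
  have h : L.idealSpan s ≤ L.idealSpan s ⊓ (L.idealSpan s).comap D := by
    refine sInf_le (show _ ∧ _ ∧ _ from
      ⟨hD.hasDegree.isGraded_inf_comap (L.idealSpan_isGraded s),
      fun x hx => ⟨L.subset_idealSpan s hx, hs x hx⟩, fun x y hy => ?_⟩)
    refine ⟨L.bracket_mem_idealSpan x hy.1, ?_⟩
    change D (L.bracket x y) ∈ L.idealSpan s
    rw [hD.leibniz']
    exact Submodule.add_mem _ (L.bracket_mem_idealSpan _ hy.1) (L.bracket_mem_idealSpan _ hy.2)
  exact fun x hx => (h hx).2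

/-- A graded derivation of an associative algebra is also one for the graded commutator. On
homogeneous elements all signs are determined by the parities of `m * p`, `e * m` and `e * p`. -/
theorem tensor {V : DGModule K} {D : V.carrier →ₗ[K] V.carrier} (hD : V.HasDegree e D) :
    (tensor V).IsDer e (V.tensorDer e D) where
  hasDegree := hD.tensorDer
  leibniz := by
    intro m (x : TensorAlgebra K V.carrier) hx (y : TensorAlgebra K V.carrier)
    change V.tensorDer e D (tensorBracket V x y) = tensorBracket V (V.tensorDer e D x) y +
      (e * m).negOnePow • tensorBracket V x (V.tensorDer e D y)
    replace hx : x ∈ V.tensorGr m := hx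
    have hx' : V.tensorDer e D x ∈ V.tensorGr (m + e) := hD.tensorDer _ _ hx
    induction y using DirectSum.Decomposition.inductionOn V.tensorGr with
    | zero => simp
    | add z w hz hw =>
      rw [map_add, map_add, hz, hw, map_add, map_add, map_add, smul_add]
      abel
    | @homogeneous p y =>
      obtain ⟨y, hy⟩ := y
      dsimp only
      have hy' : V.tensorDer e D y ∈ V.tensorGr (p + e) := hD.tensorDer _ _ hy
      rw [tensorBracket_of_mem V hx hy, tensorBracket_of_mem V hx' hy,
        tensorBracket_of_mem V hx hy', map_sub,
        Units.smul_def (m * p).negOnePow, map_zsmul, V.tensorDer_mul e D hx,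
        V.tensorDer_mul e D hy, ← Units.smul_def, add_mul, mul_add, Int.negOnePow_add,
        Int.negOnePow_add, mul_comm m e]
      rcases Int.units_eq_one_or (m * p).negOnePow with h₁ | h₁ <;>
      rcases Int.units_eq_one_or (e * m).negOnePow with h₂ | h₂ <;>
      rcases Int.units_eq_one_or (e * p).negOnePow with h₃ | h₃ <;>
      rw [h₁, h₂, h₃] <;>
      simp only [mul_one, mul_neg, neg_neg, one_smul, Units.neg_smul, sub_neg_eq_add] <;>
      abel

end IsDer

/-- The derivation of `𝕃(V)` that extends a linear map of degree `e`. -/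
def freeDer {V : DGModule K} {e : ℤ} {D : V.carrier →ₗ[K] V.carrier} (hD : V.HasDegree e D) :
    (free V).carrier →ₗ[K] (free V).carrier :=
  (V.tensorDer e D).restrict ((IsDer.tensor hD).mem_lieSpan (by
    rintro _ ⟨v, rfl⟩
    exact (tensor V).subset_lieSpan _ ⟨D v, (V.tensorDer_ι e D v).symm⟩))

theorem freeDer_freeι {V : DGModule K} {e : ℤ} {D : V.carrier →ₗ[K] V.carrier}
    (hD : V.HasDegree e D) (v : V.carrier) :
    freeDer hD ((freeι V).toLin v) = (freeι V).toLin (D v) :=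
  Subtype.ext (V.tensorDer_ι e D v)

theorem isDer_freeDer {V : DGModule K} {e : ℤ} {D : V.carrier →ₗ[K] V.carrier}
    (hD : V.HasDegree e D) : (free V).IsDer e (freeDer hD) where
  hasDegree _ _ hx := hD.tensorDer _ _ hx
  leibniz hx y := Subtype.ext ((IsDer.tensor hD).leibniz hx y.1)

/-- The differential and both derivations are restrictions from `T(V)`, where the identity is
already known. -/
theorem d_freeDer {V : DGModule K} {h N : V.carrier →ₗ[K] V.carrier} (hh : V.HasDegree (-1) h)
    (hN : V.HasDegree 0 N) (H : ∀ v, V.d (h v) + h (V.d v) = N v) (x : (free V).carrier) :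
    (free V).d (freeDer hh x) + freeDer hh ((free V).d x) = freeDer hN x :=
  Subtype.ext (V.tensorD_tensorDer hh H x.1)

section Coproduct

variable {H M : DGLieAlgebra K} {e : ℤ} {D : H.carrier →ₗ[K] H.carrier}
  {E : M.carrier →ₗ[K] M.carrier}

/-- A derivation compatible with `f` maps a defining relation of the coproduct to a sum of two such
relations. Hence it preserves the ideal that they generate. -/
theorem IsDer.apply_rel {L : DGLieAlgebra K} {F : L.carrier →ₗ[K] L.carrier}
    (hD : H.IsDer e D) (hF : L.IsDer e F) (f : DGModule.Hom H.toDGModule L.toDGModule)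
    (hf : ∀ x, F (f.toLin x) = f.toLin (D x)) (x y : H.carrier) :
    F (f.toLin (H.bracket x y) - L.bracket (f.toLin x) (f.toLin y)) =
      (f.toLin (H.bracket (D x) y) - L.bracket (f.toLin (D x)) (f.toLin y)) +
      (f.toLin (H.bracket (H.twist e x) (D y)) -
        L.bracket (f.toLin (H.twist e x)) (f.toLin (D y))) := by
  rw [map_sub, hf, hD.leibniz', hF.leibniz', ← f.map_twist, hf, hf, map_add]
  abel

theorem freeDer_coprodLeft (hD : H.IsDer e D) (hE : M.IsDer e E) (x : H.carrier) :
    freeDer (hD.hasDegree.prodMap hE.hasDegree) ((coprodLeft H M).toLin x) =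
      (coprodLeft H M).toLin (D x) := by
  refine (freeDer_freeι (hD.hasDegree.prodMap hE.hasDegree) _).trans ?_
  exact congrArg (freeι (H.toDGModule.sum M.toDGModule)).toLin (Prod.ext rfl (map_zero E) :
    D.prodMap E (x, 0) = (D x, 0))

theorem freeDer_coprodRight (hD : H.IsDer e D) (hE : M.IsDer e E) (x : M.carrier) :
    freeDer (hD.hasDegree.prodMap hE.hasDegree) ((coprodRight H M).toLin x) =
      (coprodRight H M).toLin (E x) := by
  refine (freeDer_freeι (hD.hasDegree.prodMap hE.hasDegree) _).trans ?_
  exact congrArg (freeι (H.toDGModule.sum M.toDGModule)).toLin (Prod.ext (map_zero D) rfl :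
    D.prodMap E (0, x) = (0, E x))

theorem freeDer_mem_coprodIdeal (hD : H.IsDer e D) (hE : M.IsDer e E) :
    ∀ x ∈ coprodIdeal H M, freeDer (hD.hasDegree.prodMap hE.hasDegree) x ∈ coprodIdeal H M := by
  refine (isDer_freeDer _).mem_idealSpan ?_
  rintro _ (⟨x, y, rfl⟩ | ⟨x, y, rfl⟩)
  · rw [hD.apply_rel (isDer_freeDer _) (coprodLeft H M) (freeDer_coprodLeft hD hE)]
    exact Submodule.add_mem _ (subset_idealSpan _ _ (Or.inl ⟨_, _, rfl⟩))
      (subset_idealSpan _ _ (Or.inl ⟨_, _, rfl⟩))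
  · rw [hE.apply_rel (isDer_freeDer _) (coprodRight H M) (freeDer_coprodRight hD hE)]
    exact Submodule.add_mem _ (subset_idealSpan _ _ (Or.inr ⟨_, _, rfl⟩))
      (subset_idealSpan _ _ (Or.inr ⟨_, _, rfl⟩))

/-- The derivation of `H ⨿ M` that extends derivations of `H` and `M` of the same degree. -/
def coprodDer (hD : H.IsDer e D) (hE : M.IsDer e E) :
    (coprod H M).carrier →ₗ[K] (coprod H M).carrier :=
  (coprodIdeal H M).mapQ (coprodIdeal H M) (freeDer (hD.hasDegree.prodMap hE.hasDegree))
    (freeDer_mem_coprodIdeal hD hE)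

theorem coprodDer_inl (hD : H.IsDer e D) (hE : M.IsDer e E) (x : H.carrier) :
    coprodDer hD hE ((inl H M).toLin x) = (inl H M).toLin (D x) :=
  congrArg (coprodIdeal H M).mkQ (freeDer_coprodLeft hD hE x)

theorem coprodDer_inr (hD : H.IsDer e D) (hE : M.IsDer e E) (x : M.carrier) :
    coprodDer hD hE ((inr H M).toLin x) = (inr H M).toLin (E x) :=
  congrArg (coprodIdeal H M).mkQ (freeDer_coprodRight hD hE x)

theorem isDer_coprodDer (hD : H.IsDer e D) (hE : M.IsDer e E) :
    (coprod H M).IsDer e (coprodDer hD hE) where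
  hasDegree := by
    rintro n _ ⟨x, hx, rfl⟩
    exact ⟨_, (isDer_freeDer (hD.hasDegree.prodMap hE.hasDegree)).hasDegree _ _ hx, rfl⟩
  leibniz := by
    rintro m _ ⟨x, hx, rfl⟩ y
    obtain ⟨y, rfl⟩ := (coprodIdeal H M).mkQ_surjective y
    exact congrArg (coprodIdeal H M).mkQ
      ((isDer_freeDer (hD.hasDegree.prodMap hE.hasDegree)).leibniz hx y)

/-- The homotopy identity holds on `H ⊕ M` componentwise, passes to `𝕃(H ⊕ M)` by `d_freeDer`, and
then to the quotient. -/
theorem d_coprodDer {h N : H.carrier →ₗ[K] H.carrier} {h' N' : M.carrier →ₗ[K] M.carrier}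
    (hh : H.IsDer (-1) h) (hh' : M.IsDer (-1) h') (hN : H.IsDer 0 N) (hN' : M.IsDer 0 N')
    (hH : ∀ x, H.d (h x) + h (H.d x) = N x) (hM : ∀ x, M.d (h' x) + h' (M.d x) = N' x)
    (x : (coprod H M).carrier) :
    (coprod H M).d (coprodDer hh hh' x) + coprodDer hh hh' ((coprod H M).d x) =
      coprodDer hN hN' x := by
  obtain ⟨x, rfl⟩ := (coprodIdeal H M).mkQ_surjective x
  exact congrArg (coprodIdeal H M).mkQ (d_freeDer (hh.hasDegree.prodMap hh'.hasDegree)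
    (hN.hasDegree.prodMap hN'.hasDegree) (fun v => Prod.ext (hH v.1) (hM v.2)) x)

end Coproduct

end DGLieAlgebra

/-! ### Maps of degree `0`, and induction on the free DG-Lie algebra. -/

namespace DGModule

variable {K : Type u} [Field K]

/-- A linear map of degree `0` commutes with the projections onto homogeneous components. -/
theorem map_proj {V W : DGModule K} {f : V.carrier →ₗ[K] W.carrier}
    (hf : ∀ n x, x ∈ V.gr n → f x ∈ W.gr n) (n : ℤ) (x : V.carrier) :
    f (V.proj n x) = W.proj n (f x) := by
  induction x using V.induction with
  | zero => simp
  | add x y hx hy => simp [hx, hy]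
  | hom m x hx =>
    by_cases h : m = n
    · subst h
      rw [V.proj_same hx, W.proj_same (hf _ _ hx)]
    · rw [V.proj_ne hx h, W.proj_ne (hf _ _ hx) h, map_zero]

/-- The coproduct map `V ⊕ W → X` of two morphisms. -/
def sumDesc {V W X : DGModule K} (f : Hom V X) (g : Hom W X) : Hom (V.sum W) X where
  toLin := f.toLin.coprod g.toLin
  map_mem hx := Submodule.add_mem _ (f.map_mem hx.1) (g.map_mem hx.2)
  map_d x := by
    change f.toLin (V.d x.1) + g.toLin (W.d x.2) = X.d (f.toLin x.1 + g.toLin x.2)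
    rw [f.map_d, g.map_d, map_add]

end DGModule

namespace DGLieAlgebra

variable {K : Type u} [Field K]

/-- The span of a set closed under brackets is closed under brackets. -/
theorem bracket_mem_span (L : DGLieAlgebra K) {s : Set L.carrier}
    (hs : ∀ x ∈ s, ∀ y ∈ s, L.bracket x y ∈ Submodule.span K s) {x y : L.carrier}
    (hx : x ∈ Submodule.span K s) (hy : y ∈ Submodule.span K s) :
    L.bracket x y ∈ Submodule.span K s := by
  induction hx, hy using Submodule.span_induction₂ with
  | mem_mem x y hx hy => exact hs x hx y hy
  | zero_left => simp
  | zero_right => simp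
  | add_left x y z _ _ _ h₁ h₂ =>
    rw [map_add, LinearMap.add_apply]; exact Submodule.add_mem _ h₁ h₂
  | add_right x y z _ _ _ h₁ h₂ => rw [map_add]; exact Submodule.add_mem _ h₁ h₂
  | smul_left r x y _ _ h => rw [map_smul, LinearMap.smul_apply]; exact Submodule.smul_mem _ _ h
  | smul_right r x y _ _ h => rw [map_smul]; exact Submodule.smul_mem _ _ h

/-- The inclusion `𝕃(V) → T(V)`. -/
def freeSubtype (V : DGModule K) : DGModule.Hom (free V).toDGModule V.tensor where
  toLin := Submodule.subtype _
  map_mem hx := hx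
  map_d _ := rfl

/-- An induction principle for the free DG-Lie algebra: a subspace that contains the generators
and is closed under brackets of homogeneous elements is everything. -/
theorem free_induction (V : DGModule K) (p : Submodule K (free V).carrier)
    (hι : ∀ n v, v ∈ V.gr n → (freeι V).toLin v ∈ p)
    (hb : ∀ m n x y, x ∈ (free V).gr m → y ∈ (free V).gr n → x ∈ p → y ∈ p →
      (free V).bracket x y ∈ p) (x : (free V).carrier) : x ∈ p := by
  -- The subspace `p` need not be graded, whereas `lieSpan` is an infimum over graded subspaces. The
  -- span of the homogeneous elements of `p` is graded and takes its place.
  set s : Set (free V).carrier := {x | x ∈ p ∧ ∃ n, x ∈ (free V).gr n} with hs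
  have hsp : Submodule.span K s ≤ p := Submodule.span_le.2 fun x hx => hx.1
  have hg : (free V).IsGraded (Submodule.span K s) := DGModule.isGraded_span fun x hx => hx.2
  suffices h : (tensor V).lieSpan (Set.range (TensorAlgebra.ι K : V.carrier →ₗ[K] _)) ≤
      (Submodule.span K s).map (freeSubtype V).toLin by
    obtain ⟨y, hy, hyx⟩ := h x.2
    exact hsp ((Subtype.ext hyx : y = x) ▸ hy)
  refine sInf_le (show _ ∧ _ ∧ _ from ⟨?_, ?_, ?_⟩)
  · rintro _ ⟨y, hy, rfl⟩ n
    exact ⟨(free V).proj n y, hg y hy n, DGModule.map_proj (fun _ _ => (freeSubtype V).map_mem) n y⟩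
  · rintro _ ⟨v, rfl⟩
    refine ⟨(freeι V).toLin v, ?_, rfl⟩
    induction v using V.induction with
    | zero => rw [map_zero]; exact Submodule.zero_mem _
    | add v w hv hw => rw [map_add]; exact Submodule.add_mem _ hv hw
    | hom n v hv => exact Submodule.subset_span ⟨hι n v hv, n, (freeι V).map_mem hv⟩
  · rintro _ ⟨y, hy, rfl⟩ _ ⟨z, hz, rfl⟩
    refine ⟨(free V).bracket y z, (free V).bracket_mem_span ?_ hy hz, rfl⟩
    rintro y ⟨hy, m, hm⟩ z ⟨hz, n, hn⟩
    exact Submodule.subset_span ⟨hb m n y z hm hn hy hz, _, (free V).bracket_mem hm hn⟩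

/-! ### The universal property of the free DG-Lie algebra

In characteristic `0`, a morphism `f : V → L` extends to `𝕃(V)`: the extension sends an element
`∑ v₁ ⊗ ⋯ ⊗ vₖ` of word length `k` to `k⁻¹ • ∑ [f v₁, [f v₂, ⋯, f vₖ]]`. -/

section Lift

variable {V : DGModule K} {L : DGLieAlgebra K}

/-- The bracket with an element of `L` on `L[t]`, multiplied with `t ^ k`. -/
def shiftBracket (L : DGLieAlgebra K) (k : ℕ) :
    L.carrier →ₗ[K] (ℕ →₀ L.carrier) →ₗ[K] (ℕ →₀ L.carrier) :=
  (Finsupp.lsum K).toLinearMap ∘ₗ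
    LinearMap.pi fun j => LinearMap.compRight K (Finsupp.lsingle (j + k)) ∘ₗ L.bracket

theorem shiftBracket_single (k j : ℕ) (l m : L.carrier) :
    shiftBracket L k l (Finsupp.single j m) = Finsupp.single (j + k) (L.bracket l m) := by
  simp [shiftBracket]

/-- The action of `V` on `K ⊕ L[t]` for which `v₁ ⊗ ⋯ ⊗ vₖ` sends `(1, 0)` to
`[f v₁, [f v₂, ⋯, f vₖ]] t ^ k`. -/
def nestedAction (f : V.carrier →ₗ[K] L.carrier) :
    V.carrier →ₗ[K] Module.End K (K × (ℕ →₀ L.carrier)) :=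
  LinearMap.mk₂ K
    -- The summand `K` supplies the innermost entry `f v`, and every further letter acts by its
    -- adjoint map. The power of `t` records the word length, so that `dynkin` can divide each
    -- length by its own integer.
    (fun v p => (0, p.1 • Finsupp.single 1 (f v) + shiftBracket L 1 (f v) p.2))
    (fun v w p => by simp only [map_add, Finsupp.single_add, smul_add, LinearMap.add_apply,
      Prod.mk_add_mk, add_zero, add_add_add_comm])
    (fun r v p => by simp only [map_smul, ← Finsupp.smul_single, LinearMap.smul_apply,
      Prod.smul_mk, smul_zero, smul_add, smul_comm r p.1])
    (fun v p q => by simp only [Prod.fst_add, Prod.snd_add, add_smul, map_add,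
      Prod.mk_add_mk, add_zero, add_add_add_comm])
    (fun r v p => by simp only [Prod.smul_fst, Prod.smul_snd, map_smul, Prod.smul_mk, smul_zero,
      smul_add, smul_assoc])

theorem nestedAction_apply (f : V.carrier →ₗ[K] L.carrier) (v : V.carrier)
    (p : K × (ℕ →₀ L.carrier)) :
    nestedAction f v p = (0, p.1 • Finsupp.single 1 (f v) + shiftBracket L 1 (f v) p.2) := rfl

/-- The representation of `T(V)` defined by `nestedAction`. -/
def nestedRep (f : V.carrier →ₗ[K] L.carrier) :
    TensorAlgebra K V.carrier →ₐ[K] Module.End K (K × (ℕ →₀ L.carrier)) :=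
  TensorAlgebra.lift K (nestedAction f)

/-- The linear map `v₁ ⊗ ⋯ ⊗ vₖ ↦ k⁻¹ • [f v₁, [f v₂, ⋯, f vₖ]]`. -/
def dynkin (f : V.carrier →ₗ[K] L.carrier) : TensorAlgebra K V.carrier →ₗ[K] L.carrier :=
  -- The default value `(0 : K)⁻¹ = 0` at `k = 0` does no harm, since iterated brackets have
  -- positive length.
  (Finsupp.lsum K fun k : ℕ => (k : K)⁻¹ • LinearMap.id) ∘ₗ LinearMap.snd K _ _ ∘ₗ
    LinearMap.applyₗ (1, 0) ∘ₗ (nestedRep f).toLinearMap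

/-- `x` is an iterated bracket of `k` homogeneous elements of `V`, of total degree `n`, and `l` is
the same bracket of their images under `f`. -/
inductive IteratedBracket (f : DGModule.Hom V L.toDGModule) :
    ℕ → ℤ → TensorAlgebra K V.carrier → L.carrier → Prop
  | ι {n : ℤ} {v : V.carrier} (hv : v ∈ V.gr n) :
    IteratedBracket f 1 n (TensorAlgebra.ι K v) (f.toLin v)
  | bracket {j k : ℕ} {m n : ℤ} {x y : TensorAlgebra K V.carrier} {l l' : L.carrier}
    (hx : IteratedBracket f j m x l) (hy : IteratedBracket f k n y l') :
    IteratedBracket f (j + k) (m + n) (tensorBracket V x y) (L.bracket l l')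

namespace IteratedBracket

variable {f : DGModule.Hom V L.toDGModule} {k : ℕ} {n : ℤ} {x : TensorAlgebra K V.carrier}
  {l : L.carrier}

theorem pos (h : IteratedBracket f k n x l) : 0 < k := by
  induction h with
  | ι => exact one_pos
  | bracket _ _ hx hy => omega

theorem mem_tensorGr (h : IteratedBracket f k n x l) : x ∈ V.tensorGr n := by
  induction h with
  | ι hv => exact V.ι_mem_tensorGr hv
  | bracket _ _ hx hy => exact tensorBracket_mem V hx hy

theorem mem_gr (h : IteratedBracket f k n x l) : l ∈ L.gr n := by
  induction h with
  | ι hv => exact f.map_mem hv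
  | bracket _ _ hx hy => exact L.bracket_mem hx hy

/-- On `L[t]` a Lie element acts by the adjoint map of its image: the Jacobi identity says that `ad`
sends brackets to graded commutators. -/
theorem nestedRep_single (h : IteratedBracket f k n x l) (j : ℕ) (m : L.carrier) :
    nestedRep f.toLin x (0, Finsupp.single j m) = (0, Finsupp.single (j + k) (L.bracket l m)) := by
  induction h generalizing j m with
  | ι hv => simp [nestedRep, nestedAction_apply, shiftBracket_single]
  | @bracket a b p q x y l l' hx hy ihx ihy =>
    rw [tensorBracket_of_mem V hx.mem_tensorGr hy.mem_tensorGr, map_sub, Units.smul_def, map_zsmul,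
      map_mul, map_mul, LinearMap.sub_apply, LinearMap.smul_apply, Module.End.mul_apply,
      Module.End.mul_apply, ihy, ihx, ihx, ihy, L.jacobi hx.mem_gr hy.mem_gr,
      show j + b + a = j + (a + b) by ring, show j + a + b = j + (a + b) by ring,
      Finsupp.single_add, Units.smul_def, ← Finsupp.smul_single]
    simp

/-- This is the Dynkin–Specht–Wever identity. For brackets of lengths `a` and `b`, the product `x y`
contributes `b • [l, l']`. By antisymmetry the signed product `y x` contributes `a • [l, l']`, and
the factors add up to `a + b`. -/
theorem nestedRep_one (h : IteratedBracket f k n x l) :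
    nestedRep f.toLin x (1, 0) = (0, Finsupp.single k ((k : K) • l)) := by
  induction h with
  | ι hv => simp [nestedRep, nestedAction_apply]
  | @bracket a b p q x y l l' hx hy ihx ihy =>
    rw [tensorBracket_of_mem V hx.mem_tensorGr hy.mem_tensorGr, map_sub, Units.smul_def, map_zsmul,
      map_mul, map_mul, LinearMap.sub_apply, LinearMap.smul_apply, Module.End.mul_apply,
      Module.End.mul_apply, ihy, ihx, hx.nestedRep_single, hy.nestedRep_single, add_comm b a,
      map_smul, map_smul, Nat.cast_add, add_smul]
    have := L.bracket_skew hx.mem_gr hy.mem_gr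
    rw [Units.smul_def] at this
    rw [Finsupp.single_add]
    -- Only the copy of `[l, l']` with coefficient `a` is reversed, to match the term coming from `y
    -- x`.
    nth_rw 2 [this]
    simp only [Prod.smul_mk, smul_zero, Prod.mk_sub_mk, sub_zero, smul_neg, Finsupp.single_neg,
      Finsupp.smul_single, smul_comm (a : K)]
    rw [neg_add_eq_sub]

theorem dynkin_eq [CharZero K] (h : IteratedBracket f k n x l) : dynkin f.toLin x = l := by
  have hk : (k : K) ≠ 0 := Nat.cast_ne_zero.2 h.pos.ne'
  simp [dynkin, h.nestedRep_one, hk]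

end IteratedBracket

/-- Linear identities on `𝕃(V)` may thus be checked on iterated brackets, where `dynkin_eq` gives
the value of the extension. -/
theorem mem_span_iteratedBracket (f : DGModule.Hom V L.toDGModule) (x : (free V).carrier) :
    x ∈ Submodule.span K {x : (free V).carrier | ∃ k n l, IteratedBracket f k n x.1 l} := by
  refine free_induction V _ (fun n v hv => ?_) (fun _ _ x y _ _ => bracket_mem_span _ ?_) x
  · exact Submodule.subset_span ⟨1, n, f.toLin v, IteratedBracket.ι hv⟩
  rintro y ⟨_, _, _, hy⟩ z ⟨_, _, _, hz⟩
  exact Submodule.subset_span ⟨_, _, _, hy.bracket hz⟩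

variable [CharZero K]

/-- The linear map `𝕃(V) → L` that extends a morphism `V → L`. -/
def freeLiftLin (f : DGModule.Hom V L.toDGModule) : (free V).carrier →ₗ[K] L.carrier :=
  dynkin f.toLin ∘ₗ (freeSubtype V).toLin

theorem freeLiftLin_freeι (f : DGModule.Hom V L.toDGModule) (v : V.carrier) :
    freeLiftLin f ((freeι V).toLin v) = f.toLin v := by
  induction v using V.induction with
  | zero => simp
  | add v w hv hw => rw [map_add, map_add, hv, hw, map_add]
  | hom n v hv => exact (IteratedBracket.ι hv).dynkin_eq

theorem freeLiftLin_bracket (f : DGModule.Hom V L.toDGModule) (x y : (free V).carrier) :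
    freeLiftLin f ((free V).bracket x y) = L.bracket (freeLiftLin f x) (freeLiftLin f y) := by
  induction mem_span_iteratedBracket f x, mem_span_iteratedBracket f y
    using Submodule.span_induction₂ with
  | mem_mem y z hy hz =>
    obtain ⟨_, _, _, hy⟩ := hy
    obtain ⟨_, _, _, hz⟩ := hz
    exact (hy.bracket hz).dynkin_eq.trans (congrArg₂ (fun a b => L.bracket a b)
      hy.dynkin_eq.symm hz.dynkin_eq.symm)
  | zero_left => simp
  | zero_right => simp
  | add_left x y z _ _ _ h₁ h₂ => simp only [map_add, LinearMap.add_apply, h₁, h₂]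
  | add_right x y z _ _ _ h₁ h₂ => simp only [map_add, h₁, h₂]
  | smul_left r x y _ _ h => simp only [map_smul, LinearMap.smul_apply, h]
  | smul_right r x y _ _ h => simp only [map_smul, h]

/-- Preservation of degree is expressed through projections because this form is linear in `x` and
can be checked on a spanning set. -/
theorem freeLiftLin_proj (f : DGModule.Hom V L.toDGModule) (n : ℤ) (x : (free V).carrier) :
    freeLiftLin f ((free V).proj n x) = L.proj n (freeLiftLin f x) := by
  induction mem_span_iteratedBracket f x using Submodule.span_induction with
  | zero => simp
  | add x y _ _ hx hy => simp only [map_add, hx, hy]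
  | smul r x _ hx => simp only [map_smul, hx]
  | mem x hx =>
    obtain ⟨k, m, l, h⟩ := hx
    have hx : x ∈ (free V).gr m := h.mem_tensorGr
    have hl : freeLiftLin f x = l := h.dynkin_eq
    by_cases hmn : m = n
    · subst hmn
      rw [(free V).proj_same hx, hl, L.proj_same h.mem_gr]
    · rw [(free V).proj_ne hx hmn, hl, L.proj_ne h.mem_gr hmn, map_zero]

theorem freeLiftLin_mem (f : DGModule.Hom V L.toDGModule) {n : ℤ} {x : (free V).carrier}
    (hx : x ∈ (free V).gr n) : freeLiftLin f x ∈ L.gr n := by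
  rw [← (free V).proj_same hx, freeLiftLin_proj]
  exact L.proj_mem n _

/-- The morphism of DG-Lie algebras `𝕃(V) → L` that extends a morphism of complexes `V → L`. -/
def freeLift (f : DGModule.Hom V L.toDGModule) : Hom (free V) L where
  toLin := freeLiftLin f
  map_mem := freeLiftLin_mem f
  map_d x := by
    -- The elements on which the extension commutes with `d` form a subspace containing `V`; the
    -- Leibniz rule makes it closed under brackets of homogeneous elements.
    refine sub_eq_zero.1 (LinearMap.mem_ker.1 (free_induction V
      (LinearMap.ker (freeLiftLin f ∘ₗ (free V).d - L.d ∘ₗ freeLiftLin f)) ?_ ?_ x))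
    · intro n v _
      rw [LinearMap.mem_ker, LinearMap.sub_apply, LinearMap.comp_apply, LinearMap.comp_apply,
        ← (freeι V).map_d, freeLiftLin_freeι, freeLiftLin_freeι, f.map_d, sub_self]
    · intro m n x y hx _ hdx hdy
      simp only [LinearMap.mem_ker, LinearMap.sub_apply, LinearMap.comp_apply,
        sub_eq_zero] at hdx hdy ⊢
      rw [(free V).d_bracket hx, freeLiftLin_bracket, L.d_bracket (freeLiftLin_mem f hx), map_add,
        freeLiftLin_bracket, Units.smul_def, map_zsmul, freeLiftLin_bracket, hdx, hdy,
        Units.smul_def]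
  map_bracket := freeLiftLin_bracket f

theorem freeLift_freeι (f : DGModule.Hom V L.toDGModule) (v : V.carrier) :
    (freeLift f).toLin ((freeι V).toLin v) = f.toLin v := freeLiftLin_freeι f v

end Lift

/-! ### The universal property of the coproduct -/

section Desc

variable {H M L : DGLieAlgebra K}

/-- The kernel of a morphism is itself a graded ideal, so it contains the ideal generated by any of
its subsets. -/
theorem Hom.idealSpan_le_ker (f : Hom H L) {s : Set H.carrier} (hs : ∀ x ∈ s, f.toLin x = 0) :
    H.idealSpan s ≤ LinearMap.ker f.toLin := by
  refine sInf_le (show _ ∧ _ ∧ _ from ⟨?_, hs, ?_⟩)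
  · intro x hx n
    rw [LinearMap.mem_ker] at hx ⊢
    rw [DGModule.map_proj (V := H.toDGModule) (W := L.toDGModule) (fun _ _ => f.map_mem), hx,
      map_zero]
  · intro x y hy
    rw [LinearMap.mem_ker] at hy ⊢
    rw [f.map_bracket, hy, map_zero]

variable [CharZero K]

theorem coprodIdeal_le_ker (f : Hom H L) (g : Hom M L) : coprodIdeal H M ≤
    LinearMap.ker (freeLift (DGModule.sumDesc f.toHom g.toHom)).toLin := by
  have hl (x : H.carrier) : (freeLift (DGModule.sumDesc f.toHom g.toHom)).toLin
      ((coprodLeft H M).toLin x) = f.toLin x := by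
    refine (freeLift_freeι _ _).trans ?_
    change f.toLin x + g.toLin 0 = _
    rw [map_zero, add_zero]
  have hr (x : M.carrier) : (freeLift (DGModule.sumDesc f.toHom g.toHom)).toLin
      ((coprodRight H M).toLin x) = g.toLin x := by
    refine (freeLift_freeι _ _).trans ?_
    change f.toLin 0 + g.toLin x = _
    rw [map_zero, zero_add]
  refine Hom.idealSpan_le_ker _ ?_
  rintro _ (⟨x, y, rfl⟩ | ⟨x, y, rfl⟩)
  · rw [map_sub, Hom.map_bracket, hl, hl, hl, f.map_bracket, sub_self]
  · rw [map_sub, Hom.map_bracket, hr, hr, hr, g.map_bracket, sub_self]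

/-- The morphism `H ⨿ M → L` defined by morphisms `H → L` and `M → L`. -/
def coprodDesc (f : Hom H L) (g : Hom M L) : Hom (coprod H M) L where
  toLin := (coprodIdeal H M).liftQ _ (coprodIdeal_le_ker f g)
  map_mem := by
    rintro n _ ⟨x, hx, rfl⟩
    exact (freeLift (DGModule.sumDesc f.toHom g.toHom)).map_mem hx
  map_d x := by
    obtain ⟨x, rfl⟩ := (coprodIdeal H M).mkQ_surjective x
    exact (freeLift (DGModule.sumDesc f.toHom g.toHom)).map_d x
  map_bracket x y := by
    obtain ⟨x, rfl⟩ := (coprodIdeal H M).mkQ_surjective x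
    obtain ⟨y, rfl⟩ := (coprodIdeal H M).mkQ_surjective y
    exact (freeLift (DGModule.sumDesc f.toHom g.toHom)).map_bracket x y

theorem coprodDesc_inl (f : Hom H L) (g : Hom M L) (x : H.carrier) :
    (coprodDesc f g).toLin ((inl H M).toLin x) = f.toLin x := by
  refine (freeLift_freeι (DGModule.sumDesc f.toHom g.toHom) _).trans ?_
  change f.toLin x + g.toLin 0 = _
  rw [map_zero, add_zero]

end Desc

end DGLieAlgebra

namespace DGModule

variable {K : Type u} [Field K]

/-! ### Contracting homotopies -/

theorem toCochainComplex_d_apply (V : DGModule K) {i j : ℤ} (h : i + 1 = j) (x : V.gr i) :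
    (V.gr j).subtype ((V.toCochainComplex.d i j).hom x) = V.d x := by
  simp only [toCochainComplex, dif_pos h]
  rfl

/-- An acyclic complex is exact at every homogeneous cycle. -/
theorem Acyclic.exists_d_eq {V : DGModule K} (hV : V.Acyclic) {n : ℤ} {x : V.carrier}
    (hx : x ∈ V.gr n) (hdx : V.d x = 0) : ∃ y, V.d y = x := by
  have h := hV n
  rw [V.toCochainComplex.exactAt_iff' (n - 1) n (n + 1) (by simp) (by simp),
    ShortComplex.moduleCat_exact_iff] at h
  obtain ⟨y, hy⟩ := h (⟨x, hx⟩ : V.gr n)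
    (Subtype.ext ((V.toCochainComplex_d_apply rfl _).trans hdx))
  exact ⟨(y : V.gr (n - 1)).1, (V.toCochainComplex_d_apply (by omega) y).symm.trans
    (congrArg Subtype.val hy)⟩

/-- Every linear map between vector spaces has a generalised inverse. -/
theorem exists_generalized_inverse {V W : Type u} [AddCommGroup V] [Module K V] [AddCommGroup W]
    [Module K W] (f : V →ₗ[K] W) : ∃ g : W →ₗ[K] V, ∀ x, f (g (f x)) = f x := by
  -- A linear section of `f` over its range, extended to all of `W`, is the required `g`.
  obtain ⟨s, hs⟩ := f.rangeRestrict.exists_rightInverse_of_surjective f.range_rangeRestrict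
  obtain ⟨g, hg⟩ := s.exists_extend
  refine ⟨g, fun x => ?_⟩
  have h₁ : g (f x) = s (f.rangeRestrict x) := LinearMap.congr_fun hg (f.rangeRestrict x)
  have h₂ := LinearMap.congr_fun hs (f.rangeRestrict x)
  rw [h₁]
  exact congrArg Subtype.val h₂

/-- The component of degree `e` of a linear map. -/
def degreePart (V : DGModule K) (e : ℤ) (g : V.carrier →ₗ[K] V.carrier) :
    V.carrier →ₗ[K] V.carrier :=
  DirectSum.toModule K ℤ _ (fun n => V.proj (n + e) ∘ₗ g ∘ₗ (V.gr n).subtype) ∘ₗ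
    (DirectSum.decomposeLinearEquiv V.gr).toLinearMap

theorem degreePart_of_mem (V : DGModule K) (e : ℤ) (g : V.carrier →ₗ[K] V.carrier) {n : ℤ}
    {x : V.carrier} (hx : x ∈ V.gr n) : V.degreePart e g x = V.proj (n + e) (g x) := by
  simp only [degreePart, LinearMap.comp_apply, LinearEquiv.coe_coe,
    DirectSum.decomposeLinearEquiv_apply]
  rw [DirectSum.decompose_of_mem V.gr hx]
  exact DirectSum.toModule_lof K (M := fun n => V.gr n) n (⟨x, hx⟩ : V.gr n)

theorem hasDegree_degreePart (V : DGModule K) (e : ℤ) (g : V.carrier →ₗ[K] V.carrier) :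
    V.HasDegree e (V.degreePart e g) := by
  intro n x hx
  rw [V.degreePart_of_mem e g hx]
  exact V.proj_mem _ _

/-- An acyclic complex of vector spaces has a contracting homotopy. -/
theorem Acyclic.exists_homotopy {V : DGModule K} (hV : V.Acyclic) :
    ∃ h : V.carrier →ₗ[K] V.carrier, V.HasDegree (-1) h ∧ ∀ x, V.d (h x) + h (V.d x) = x := by
  obtain ⟨g, hg⟩ := exists_generalized_inverse V.d
  -- The generalised inverse `g` need not be homogeneous. Its component of degree `-1` still
  -- satisfies `d s d = d`, because `d` is homogeneous of degree `1`.
  set s := V.degreePart (-1) g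
  have hs : V.HasDegree (-1) s := V.hasDegree_degreePart _ _
  have hds (x : V.carrier) : V.d (s (V.d x)) = V.d x := by
    induction x using V.induction with
    | zero => simp
    | add x y hx hy => simp only [map_add, hx, hy]
    | hom n x hx =>
      rw [V.degreePart_of_mem _ _ (V.d_mem hx), add_neg_cancel_right, ← V.proj_d, hg,
        V.proj_same (V.d_mem hx)]
  have hcycle (x : V.carrier) (hx : V.d x = 0) : ∃ y, V.d y = x := by
    have : x ∈ LinearMap.range V.d := by
      refine V.mem_sum_proj _ x fun n => ?_
      obtain ⟨y, hy⟩ := hV.exists_d_eq (V.proj_mem n x) (by rw [← V.proj_d, hx, map_zero])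
      exact ⟨y, hy⟩
    exact this
  -- For this homotopy `h`, `d² = 0` gives `h d x = s d x` and `d h x = d s (x - s d x)`. Since `x -
  -- s d x` is a cycle, it is some `d y`, and `d s d y = d y` makes the two terms add up to `x`.
  refine ⟨s - s ∘ₗ s ∘ₗ V.d, fun n x hx => ?_, fun x => ?_⟩
  · refine Submodule.sub_mem _ (hs _ _ hx) ?_
    have := hs _ _ (hs _ _ (V.d_mem hx))
    rwa [add_neg_cancel_right] at this
  · obtain ⟨y, hy⟩ := hcycle (x - s (V.d x)) (by rw [map_sub, hds, sub_self])
    simp only [LinearMap.sub_apply, LinearMap.comp_apply, V.d_d, map_zero, sub_zero]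
    rw [← map_sub s, ← hy, hds, hy, sub_add_cancel]

/-! ### A criterion for quasi-isomorphisms -/

/-- A morphism with a left inverse is a quasi-isomorphism when every homogeneous cycle of its
target is the image of a cycle, up to a boundary. -/
theorem Hom.isQuasiIso_of_retraction {V W : DGModule K} (f : Hom V W) (r : Hom W V)
    (hr : ∀ x, r.toLin (f.toLin x) = x)
    (hf : ∀ y, W.d y = 0 → ∃ x z, V.d x = 0 ∧ y = f.toLin x + W.d z) : f.IsQuasiIso := by
  refine ⟨fun n => ?_⟩
  rw [quasiIsoAt_iff_isIso_homologyMap]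
  have hmono : Mono (HomologicalComplex.homologyMap f.toCochainMap n) := by
    have : f.toCochainMap ≫ r.toCochainMap = 𝟙 _ := by
      ext m x
      exact Subtype.ext (hr _)
    have : HomologicalComplex.homologyMap f.toCochainMap n ≫
        HomologicalComplex.homologyMap r.toCochainMap n = 𝟙 _ := by
      rw [← HomologicalComplex.homologyMap_comp, this,
        HomologicalComplex.homologyMap_id]
    exact mono_of_mono_fac this
  have hepi : Epi (HomologicalComplex.homologyMap f.toCochainMap n) := by
    rw [HomologicalComplex.epi_homologyMap_iff_up_to_refinements _ (n - 1) n (n + 1)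
      (by simp) (by simp)]
    intro A y hy
    -- `P` consists of the triples `(a, x, z)` with `y a = f x + d z` and `d x = 0`. Its projection
    -- to `A` is the refinement over which the cycle lifts, so `x` and `z` need not be chosen
    -- linearly in `a`.
    let P : Submodule K (A × V.gr n × W.gr (n - 1)) :=
      LinearMap.ker ((W.gr n).subtype ∘ₗ y.hom ∘ₗ LinearMap.fst K _ _ -
        f.toLin ∘ₗ (V.gr n).subtype ∘ₗ LinearMap.fst K _ _ ∘ₗ LinearMap.snd K _ _ -
        W.d ∘ₗ (W.gr (n - 1)).subtype ∘ₗ LinearMap.snd K _ _ ∘ₗ LinearMap.snd K _ _) ⊓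
      LinearMap.ker (V.d ∘ₗ (V.gr n).subtype ∘ₗ LinearMap.fst K _ _ ∘ₗ LinearMap.snd K _ _)
    have hP (p : P) : (W.gr n).subtype (y.hom p.1.1) =
        f.toLin p.1.2.1 + W.d p.1.2.2 ∧ V.d p.1.2.1 = 0 := by
      refine ⟨?_, p.2.2⟩
      have := p.2.1
      rw [sub_sub] at this
      exact sub_eq_zero.1 this
    refine ⟨ModuleCat.of K P, ModuleCat.ofHom (LinearMap.fst K _ _ ∘ₗ P.subtype), ?_,
      ModuleCat.ofHom (LinearMap.fst K _ _ ∘ₗ LinearMap.snd K _ _ ∘ₗ P.subtype), ?_,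
      ModuleCat.ofHom (LinearMap.snd K _ _ ∘ₗ LinearMap.snd K _ _ ∘ₗ P.subtype), ?_⟩
    · rw [ModuleCat.epi_iff_surjective]
      intro a
      set b : W.gr n := y.hom a with hb
      have hda : W.d b = 0 := by
        exact (W.toCochainComplex_d_apply rfl b).symm.trans
          (congrArg Subtype.val (ConcreteCategory.congr_hom hy a))
      obtain ⟨x, z, hx, hxz⟩ := hf b hda
      -- The given `x` and `z` may be inhomogeneous. Their components of degrees `n` and `n - 1`
      -- still solve the equation, since `f` and `d` are homogeneous.
      refine ⟨⟨(a, ⟨V.proj n x, V.proj_mem n x⟩, ⟨W.proj (n - 1) z, W.proj_mem _ z⟩), ?_, ?_⟩,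
        rfl⟩
      · change (b : W.carrier) - f.toLin (V.proj n x) - W.d (W.proj (n - 1) z) = 0
        rw [map_proj (fun _ _ => f.map_mem), ← W.proj_d, sub_add_cancel, sub_sub, ← map_add, ← hxz,
          W.proj_same b.2, sub_self]
      · change V.d (V.proj n x) = 0
        rw [← V.proj_d, hx, map_zero]
    · ext p
      exact Subtype.ext ((V.toCochainComplex_d_apply rfl _).trans (hP p).2)
    · ext p
      refine Subtype.ext ((hP p).1.trans (congrArg₂ (· + ·) rfl ?_))
      exact (W.toCochainComplex_d_apply (by omega) _).symm
  exact isIso_of_mono_of_epi _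

end DGModule

/-! ### The Euler derivation and the weight decomposition of `A ⨿ 𝕃(V)`. -/

namespace DGLieAlgebra

variable {K : Type u} [Field K]

/-- The zero morphism of DG-Lie algebras. -/
def Hom.zero (L M : DGLieAlgebra K) : Hom L M where
  toLin := 0
  map_mem _ := Submodule.zero_mem _
  map_d _ := by simp
  map_bracket _ _ := by simp

/-- An induction principle for the coproduct with a free DG-Lie algebra. -/
theorem coprod_free_induction (A : DGLieAlgebra K) (V : DGModule K)
    (p : Submodule K (coprod A (free V)).carrier)
    (hl : ∀ n a, a ∈ A.gr n → (inl A (free V)).toLin a ∈ p)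
    (hr : ∀ n v, v ∈ V.gr n → (inr A (free V)).toLin ((freeι V).toLin v) ∈ p)
    (hb : ∀ x y, x ∈ p → y ∈ p → (coprod A (free V)).bracket x y ∈ p)
    (x : (coprod A (free V)).carrier) : x ∈ p := by
  obtain ⟨x, rfl⟩ := (coprodIdeal A (free V)).mkQ_surjective x
  have hl' (a : A.carrier) : (inl A (free V)).toLin a ∈ p := by
    induction a using A.induction with
    | zero => rw [map_zero]; exact Submodule.zero_mem _
    | add v w hv hw => rw [map_add]; exact Submodule.add_mem _ hv hw
    | hom n a ha => exact hl n a ha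
  have hr' (y : (free V).carrier) : (inr A (free V)).toLin y ∈ p := by
    refine free_induction V (p.comap (inr A (free V)).toLin) hr ?_ y
    intro m n x y _ _ hx hy
    rw [Submodule.mem_comap, (inr A (free V)).map_bracket]
    exact hb _ _ hx hy
  -- This second use of `free_induction` concerns `𝕃(A ⊕ 𝕃(V))`, whose generators split as `(a, 0) +
  -- (0, y)`.
  refine free_induction _ (p.comap (coprodIdeal A (free V)).mkQ) ?_ ?_ x
  · rintro n ⟨a, y⟩ -
    have : (coprodIdeal A (free V)).mkQ
        ((freeι (A.toDGModule.sum (free V).toDGModule)).toLin (a, y)) =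
        (inl A (free V)).toLin a + (inr A (free V)).toLin y := by
      have h : ((a, y) : A.carrier × (free V).carrier) = (a, 0) + (0, y) := by simp
      rw [h]
      exact (congrArg (coprodIdeal A (free V)).mkQ (map_add (freeι _).toLin _ _)).trans
        (map_add _ _ _)
    change (coprodIdeal A (free V)).mkQ ((freeι _).toLin (a, y)) ∈ p
    rw [this]
    exact Submodule.add_mem _ (hl' a) (hr' y)
  · intro m n x y _ _ hx hy
    exact hb _ _ hx hy

/-- The derivation of `A ⨿ 𝕃(V)` that vanishes on `A` and extends a linear map of `V`. -/
def relativeDer (A : DGLieAlgebra K) {V : DGModule K} {e : ℤ} {D : V.carrier →ₗ[K] V.carrier}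
    (hD : V.HasDegree e D) : (coprod A (free V)).carrier →ₗ[K] (coprod A (free V)).carrier :=
  coprodDer (IsDer.zero A e) (isDer_freeDer hD)

/-- The derivation of `A ⨿ 𝕃(V)` that counts the generators in `V`. -/
def euler (A : DGLieAlgebra K) (V : DGModule K) :
    (coprod A (free V)).carrier →ₗ[K] (coprod A (free V)).carrier :=
  relativeDer A (DGModule.HasDegree.id V)

theorem euler_inl (A : DGLieAlgebra K) (V : DGModule K) (a : A.carrier) :
    euler A V ((inl A (free V)).toLin a) = 0 :=
  (coprodDer_inl (IsDer.zero A 0) (isDer_freeDer (DGModule.HasDegree.id V)) a).trans (map_zero _)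

theorem euler_inr_freeι (A : DGLieAlgebra K) (V : DGModule K) (v : V.carrier) :
    euler A V ((inr A (free V)).toLin ((freeι V).toLin v)) =
      (inr A (free V)).toLin ((freeι V).toLin v) :=
  (coprodDer_inr (IsDer.zero A 0) (isDer_freeDer (DGModule.HasDegree.id V)) _).trans (congrArg _ (freeDer_freeι _ v))

theorem euler_bracket (A : DGLieAlgebra K) (V : DGModule K) (x y : (coprod A (free V)).carrier) :
    euler A V ((coprod A (free V)).bracket x y) =
      (coprod A (free V)).bracket (euler A V x) y + (coprod A (free V)).bracket x (euler A V y) :=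
  (isDer_coprodDer (IsDer.zero A 0) (isDer_freeDer (DGModule.HasDegree.id V))).leibniz_zero x y

/-- The Euler derivation is null-homotopic: on `A` the identity reads `0 = 0`, and on `𝕃(V)` it
extends the contraction of `V`. -/
theorem d_relativeDer (A : DGLieAlgebra K) {V : DGModule K} {h : V.carrier →ₗ[K] V.carrier}
    (hh : V.HasDegree (-1) h) (H : ∀ v, V.d (h v) + h (V.d v) = v)
    (x : (coprod A (free V)).carrier) :
    (coprod A (free V)).d (relativeDer A hh x) + relativeDer A hh ((coprod A (free V)).d x) =
      euler A V x :=
  d_coprodDer _ _ (IsDer.zero A 0) (isDer_freeDer (DGModule.HasDegree.id V)) (fun _ => by simp) (d_freeDer hh _ H) x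

/-- The elements of positive weight in `V` of `A ⨿ 𝕃(V)`. -/
def positivePart (A : DGLieAlgebra K) (V : DGModule K) :
    Submodule K (coprod A (free V)).carrier :=
  Submodule.span K {x | ∃ k : ℕ, k ≠ 0 ∧ euler A V x = (k : K) • x}

/-- Weights add under brackets because `euler` is a derivation, and `A` has weight `0`. Elements of
`A` and eigenvectors of positive weight therefore form a set closed under brackets, and it contains
the generators. -/
theorem exists_eq_inl_add (A : DGLieAlgebra K) (V : DGModule K)
    (x : (coprod A (free V)).carrier) :
    ∃ a, ∃ y ∈ positivePart A V, x = (inl A (free V)).toLin a + y := by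
  have h : x ∈ Submodule.span K (Set.range (inl A (free V)).toLin ∪
      {x | ∃ k : ℕ, k ≠ 0 ∧ euler A V x = (k : K) • x}) := by
    refine coprod_free_induction A V _ (fun n a _ => ?_) (fun n v _ => ?_) (fun x y hx hy => ?_) x
    · exact Submodule.subset_span (Or.inl ⟨a, rfl⟩)
    · exact Submodule.subset_span (Or.inr ⟨1, one_ne_zero, by
        rw [euler_inr_freeι, Nat.cast_one, one_smul]⟩)
    · refine bracket_mem_span _ ?_ hx hy
      rintro _ (⟨a, rfl⟩ | ⟨j, hj, hx⟩) _ (⟨b, rfl⟩ | ⟨k, hk, hy⟩)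
      · exact Submodule.subset_span (Or.inl ⟨A.bracket a b, (inl A (free V)).map_bracket a b⟩)
      · refine Submodule.subset_span (Or.inr ⟨k, hk, ?_⟩)
        rw [euler_bracket, euler_inl, hy, map_zero, LinearMap.zero_apply, zero_add, map_smul]
      · refine Submodule.subset_span (Or.inr ⟨j, hj, ?_⟩)
        rw [euler_bracket, euler_inl, hx, map_zero, add_zero, map_smul, LinearMap.smul_apply]
      · refine Submodule.subset_span (Or.inr ⟨j + k, by omega, ?_⟩)
        rw [euler_bracket, hx, hy, map_smul, map_smul, LinearMap.smul_apply, Nat.cast_add,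
          add_smul]
  rw [Submodule.span_union, ← LinearMap.coe_range, Submodule.span_eq] at h
  obtain ⟨_, ⟨a, rfl⟩, y, hy, rfl⟩ := Submodule.mem_sup.1 h
  exact ⟨a, y, hy, rfl⟩

theorem map_mem_positivePart {A : DGLieAlgebra K} {V : DGModule K}
    {f : (coprod A (free V)).carrier →ₗ[K] (coprod A (free V)).carrier}
    (hf : ∀ x, euler A V (f x) = f (euler A V x)) {x : (coprod A (free V)).carrier}
    (hx : x ∈ positivePart A V) : f x ∈ positivePart A V := by
  have : positivePart A V ≤ (positivePart A V).comap f := by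
    refine Submodule.span_le.2 ?_
    rintro y ⟨k, hk, hy⟩
    exact Submodule.subset_span ⟨k, hk, by rw [hf, hy, map_smul]⟩
  exact this hx

variable [CharZero K]

/-- Eigenspaces for distinct eigenvalues are independent, and in characteristic `0` the positive
weights remain different from `0` in `K`. -/
theorem eq_zero_of_euler_eq_zero {A : DGLieAlgebra K} {V : DGModule K}
    {x : (coprod A (free V)).carrier} (hx : x ∈ positivePart A V) (h : euler A V x = 0) :
    x = 0 := by
  have hdis := Module.End.eigenspaces_iSupIndep (euler A V) 0
  refine Submodule.disjoint_def.1 hdis x ?_ ?_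
  · rw [Module.End.mem_eigenspace_iff, h, zero_smul]
  · refine Submodule.span_le.2 ?_ hx
    rintro y ⟨k, hk, hy⟩
    exact Submodule.mem_iSup_of_mem (k : K) (Submodule.mem_iSup_of_mem (Nat.cast_ne_zero.2 hk)
      (Module.End.mem_eigenspace_iff.2 hy))

theorem exists_euler_eq {A : DGLieAlgebra K} {V : DGModule K} {x : (coprod A (free V)).carrier}
    (hx : x ∈ positivePart A V) : ∃ y ∈ positivePart A V, euler A V y = x := by
  have : positivePart A V ≤ (positivePart A V).map (euler A V) := by
    refine Submodule.span_le.2 ?_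
    rintro y ⟨k, hk, hy⟩
    refine ⟨(k : K)⁻¹ • y, Submodule.smul_mem _ _ (Submodule.subset_span ⟨k, hk, hy⟩), ?_⟩
    rw [map_smul, hy, inv_smul_smul₀ (Nat.cast_ne_zero.2 hk)]
  exact this hx

end DGLieAlgebra

end

/-! ### The canonical morphism is a quasi-isomorphism. -/

theorem mainTheorem4 (K : Type u) [Field K] [CharZero K] (A : DGLieAlgebra K) (V : DGModule K)
    (hV : V.Acyclic) :
    (DGLieAlgebra.inl A (DGLieAlgebra.free V)).toHom.IsQuasiIso := by
  set C := DGLieAlgebra.coprod A (DGLieAlgebra.free V)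
  set i := DGLieAlgebra.inl A (DGLieAlgebra.free V)
  let r : DGLieAlgebra.Hom C A := DGLieAlgebra.coprodDesc
    { toLin := LinearMap.id, map_mem := id, map_d := fun _ => rfl, map_bracket := fun _ _ => rfl }
    (DGLieAlgebra.Hom.zero _ _)
  have hr (a : A.carrier) : r.toLin (i.toLin a) = a := DGLieAlgebra.coprodDesc_inl _ _ a
  obtain ⟨h, hh, H⟩ := hV.exists_homotopy
  have hN := DGLieAlgebra.d_relativeDer A hh H
  have hNd (x : C.carrier) :
      DGLieAlgebra.euler A V (C.d x) = C.d (DGLieAlgebra.euler A V x) := by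
    -- With `N = d h + h d` and `d² = 0`, both sides equal `d h d x`.
    rw [← hN, ← hN, map_add, C.d_d, C.d_d, map_zero, add_zero, zero_add]
  refine i.toHom.isQuasiIso_of_retraction r.toHom hr fun x hx => ?_
  obtain ⟨a, y, hy, rfl⟩ := DGLieAlgebra.exists_eq_inl_add A V x
  rw [map_add, ← i.map_d] at hx
  -- The element `d y` has positive weight and equals `-i(d a)`, which has weight `0`; so it
  -- vanishes.
  have hdy : C.d y = 0 := by
    refine DGLieAlgebra.eq_zero_of_euler_eq_zero (DGLieAlgebra.map_mem_positivePart hNd hy) ?_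
    rw [eq_neg_of_add_eq_zero_right hx, map_neg, DGLieAlgebra.euler_inl, neg_zero]
  -- Writing `y = N z` gives `N (d z) = d y = 0`, hence `d z = 0` and `y = d h z + h d z = d (h z)`.
  obtain ⟨z, hz, rfl⟩ := DGLieAlgebra.exists_euler_eq hy
  have hdz : C.d z = 0 := DGLieAlgebra.eq_zero_of_euler_eq_zero
    (DGLieAlgebra.map_mem_positivePart hNd hz) ((hNd z).trans hdy)
  refine ⟨a, DGLieAlgebra.relativeDer A hh z, ?_, ?_⟩
  · rw [hdy, add_zero] at hx
    -- The retraction turns `i (d a) = 0` into `d a = 0`.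
    rw [← hr (A.d a), hx, map_zero]
  · rw [← hN z, hdz, map_zero, add_zero]
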